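/- Let $(\theta_j)_{j\ge1}$, $(\kappa_j)_{j\ge1}$ be sequences of nonnegative reals. For a permutation $\sigma\in S_N$ let $C_j=C_j(\sigma)$ be the number of cycles of length $j$ (fixed points are cycles of length $1$), and let $\mathbb P_N$ (with expectation $\mathbb E_N$) be the probability measure on $S_N$ given by $$\mathbb P_N(\sigma)=\frac1{N!\,H_N}\prod_{j=1}^N(\theta_j+N\kappa_j)^{C_j},\qquad H_N=\frac1{N!}\sum_{\sigma\in S_N}\prod_{j=1}^N(\theta_j+N\kappa_j)^{C_j}$$ (it is defined whenever $H_N>0$, which holds for all large $N$ under the assumptions below). Assume that $(\kappa_j)$ is non-arithmetic (no integer $d>1$ divides every $j$ with $\kappa_j\neq0$) and that $\kappa_j>0$ for some $j\ge2$. Put $g_\theta(z)=\sum_{j\ge1}\frac{\theta_j}{j}z^j$, $g_\kappa(z)=\sum_{j\ge1}\frac{\kappa_j}{j}z^j$, $g^{\{n\}}(z)=z^n\frac{d^n g}{dz^n}(z)$; let $R\in(0,\infty]$ be the radius of convergence of $g_\kappa$, and $g^{\{n\}}(R)=\lim_{r\uparrow R}g^{\{n\}}(r)\in[0,\infty]$.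 Assume that the radius of convergence of $g_\theta$ is at least $R$. For $R<\infty$, $\eta>0$, $\varphi\in(0,\pi/2)$ let $$\Delta_0=\{z\in\mathbb C:\ |z|<|R(1+\eta e^{i\varphi})|,\ z\ne R,\ |\arg(z-R)|>\varphi\};$$ below, "$g$ is holomorphic in $\Delta_0$" means that $g$ extends holomorphically from the disk $|z|<R$ to $\Delta_0$, and $O$-relations are for $z\to R$, $z\in\Delta_0$. Suppose that one of the following six conditions holds; in conditions 2–6, $R<\infty$, and $\delta>0$ is some constant. 1. (Subcritical) $1<g_\kappa^{\{1\}}(R)\le\infty$. 2. (Supercritical) $g_\kappa^{\{1\}}(R)<1$; for some $\eta,\varphi$, both $g_\theta$ and $g_\kappa$ are holomorphic in $\Delta_0$, $g_\theta(z)=-\theta^*\log(1-z/R)+O((1-z/R)^\delta)$ with some $\theta^*>0$, and $g_\kappa(z)=g_\kappa(R)-g_\kappa^{\{1\}}(R)(1-z/R)+O((1-z/R)^{1+\delta})$. 3. (Supercritical) $g_\kappa^{\{1\}}(R)<1$; for some $\eta,\varphi$, both $g_\theta$ and $g_\kappa$ are holomorphic in $\Delta_0$, $g_\theta$ is regular at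 $z=R$, and there are a non-integer $s>1$ and a real $a_s\ne0$ such that $g_\kappa^{\{n\}}(R)<\infty$ for $n<s$, $g_\kappa^{\{n\}}(R)=\infty$ for $n>s$, and $$g_\kappa(z)=\sum_{0\le n<s}\frac{(-1)^n g_\kappa^{\{n\}}(R)}{n!}(1-z/R)^n+a_s(1-z/R)^s+O((1-z/R)^{s+\delta}).$$ 4. (Critical) $g_\theta(R)<\infty$, $g_\kappa(R)<\infty$, $g_\kappa^{\{1\}}(R)=1$, $0<g_\kappa^{\{2\}}(R)<\infty$. 5. (Critical) $g_\kappa^{\{1\}}(R)=1$, $0<g_\kappa^{\{2\}}(R)<\infty$; for some $\eta,\varphi$, both $g_\theta$ and $g_\kappa$ are holomorphic in $\Delta_0$, $g_\theta(z)=-\theta^*\log(1-z/R)+O((1-z/R)^\delta)$ with some $\theta^*\ge0$, and $g_\kappa(z)=g_\kappa(R)-(1-z/R)+\frac12g_\kappa^{\{2\}}(R)(1-z/R)^2+O((1-z/R)^{2+\delta})$. 6. (Critical) $g_\kappa^{\{1\}}(R)=1$; for some $\eta,\varphi$, both $g_\theta$ and $g_\kappa$ are holomorphic in $\Delta_0$,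 $g_\theta(z)=-\theta^*\log(1-z/R)+O((1-z/R)^\delta)$ with some $\theta^*\ge0$, and $g_\kappa(z)=g_\kappa(R)-(1-z/R)+a_s(1-z/R)^s+O((1-z/R)^{s+\delta})$ with some $s\in(1,2)$, $a_s>0$. Then there is exactly one real number $r_*$ with $0<r_*\le R$ such that $g_\kappa^{\{1\}}(r_*)=1$ if $g_\kappa^{\{1\}}(R)\ge1$ and $r_*=R$ if $g_\kappa^{\{1\}}(R)\le1$. Writing $(x)_n=x(x-1)\cdots(x-n+1)$, $(x)_0=1$, the following hold. (a) For each $m$ and any integers $n_1,\dots,n_m\ge0$, $$\lim_{N\to\infty}N^{-(n_1+\dots+n_m)}\,\mathbb E_N\Bigl[\prod_{j=1}^m(C_j)_{n_j}\Bigr]=\prod_{j=1}^m\Bigl(\frac{\kappa_jr_*^j}{j}\Bigr)^{n_j}.$$ In particular, the random variables $C_j/N$ ($j\ge1$) are asymptotically independent and, for each $j\ge1$, $C_j/N\to\kappa_jr_*^j/j$ in probability as $N\to\infty$. (b) If $\kappa_j=0$ but $\theta_j>0$ for some $j\ge1$, then $\lim_{N\to\infty}\mathbb E_N[(C_j)_n]=(\theta_jr_*^j/j)^n$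 for every integer $n\ge0$, and $C_j$ converges weakly to the Poisson law with parameter $\theta_jr_*^j/j$. Asymptotic independence also holds when counts with $\kappa_j=0$ are not normalized: for every set $U\subseteq\{j\ge 1:\kappa_j=0\}$, the random variables $C_j$ ($j\in U$) and $C_j/N$ ($j\notin U$) are asymptotically independent. Here random variables $X_{N,j}$ ($j\ge1$) are called asymptotically independent if, for every finite set $J$ of indices and all bounded continuous $f_j:\mathbb R\to\mathbb R$ ($j\in J$), $\mathbb E_N[\prod_{j\in J}f_j(X_{N,j})]-\prod_{j\in J}\mathbb E_N[f_j(X_{N,j})]\to0$ as $N\to\infty$. -/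

import Mathlib

open Filter Topology Asymptotics ProbabilityTheory
open scoped ENNReal NNReal BoundedContinuousFunction

namespace SurrogateSpatial

noncomputable section

/-! ### The surrogate-spatial measure on permutations

The parameters are real sequences `θ j`, `κ j` with `j ≥ 1`; the value at `j = 0` is never used. -/

/-- `C_j(σ)`: the number of cycles of length `j` of `σ`, fixed points being cycles of length `1`. -/
def cycleCount {N : ℕ} (j : ℕ) (σ : Equiv.Perm (Fin N)) : ℕ :=
  σ.partition.parts.count j

/-- `∏_{j=1}^N (θ_j + N κ_j)^{C_j(σ)}`. -/
def cycleWeight (θ κ : ℕ → ℝ) (N : ℕ) (σ : Equiv.Perm (Fin N)) : ℝ :=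
  ∏ j ∈ Finset.Icc 1 N, (θ j + N * κ j) ^ cycleCount j σ

/-- The normalization constant `H_N`. -/
def normConst (θ κ : ℕ → ℝ) (N : ℕ) : ℝ :=
  (1 / (N.factorial : ℝ)) * ∑ σ : Equiv.Perm (Fin N), cycleWeight θ κ N σ

/-- The probability of the permutation `σ`. (If `H_N = 0` the measure does not exist, and this
is the zero function.) -/
def permProb (θ κ : ℕ → ℝ) (N : ℕ) (σ : Equiv.Perm (Fin N)) : ℝ :=
  cycleWeight θ κ N σ / (N.factorial * normConst θ κ N)

/-- The expectation of `X` with respect to the surrogate-spatial measure. -/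
def expect (θ κ : ℕ → ℝ) (N : ℕ) (X : Equiv.Perm (Fin N) → ℝ) : ℝ :=
  ∑ σ : Equiv.Perm (Fin N), permProb θ κ N σ * X σ

/-- The probability of the event `A` with respect to the surrogate-spatial measure. -/
def prob (θ κ : ℕ → ℝ) (N : ℕ) (A : Set (Equiv.Perm (Fin N))) : ℝ :=
  expect θ κ N (A.indicator fun _ => 1)

/-- Convergence in probability, as `N → ∞`, to a constant. -/
def TendstoInProb (θ κ : ℕ → ℝ) (X : (N : ℕ) → Equiv.Perm (Fin N) → ℝ) (c : ℝ) : Prop :=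
  ∀ ε : ℝ, 0 < ε → Tendsto (fun N => prob θ κ N {σ | ε ≤ |X N σ - c|}) atTop (𝓝 0)

/-- Weak convergence, as `N → ∞`, to the Poisson law with parameter `r`. -/
def TendstoPoisson (θ κ : ℕ → ℝ) (X : (N : ℕ) → Equiv.Perm (Fin N) → ℝ) (r : ℝ≥0) : Prop :=
  ∀ f : ℝ →ᵇ ℝ, Tendsto (fun N => expect θ κ N fun σ => f (X N σ)) atTop
    (𝓝 (∫ k : ℕ, f (k : ℝ) ∂poissonMeasure r))

/-- Asymptotic independence of the random variables `X N j`, `j ≥ 1`, as `N → ∞`: for any finite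
set of indices and any bounded continuous functions, the expectation of the product and the
product of the expectations differ by `o(1)`. -/
def AsympIndep (θ κ : ℕ → ℝ) (X : (N : ℕ) → ℕ → Equiv.Perm (Fin N) → ℝ) : Prop :=
  ∀ J : Finset ℕ, (∀ j ∈ J, 1 ≤ j) → ∀ f : ℕ → ℝ →ᵇ ℝ,
    Tendsto (fun N => expect θ κ N (fun σ => ∏ j ∈ J, f j (X N j σ)) -
      ∏ j ∈ J, expect θ κ N (fun σ => f j (X N j σ))) atTop (𝓝 0)

/-! ### Generating functions -/

/-- The generating function `g_a(z) = ∑_{j ≥ 1} (a_j / j) z^j` (the term `j = 0` is zero). -/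
def genFun (a : ℕ → ℝ) (z : ℂ) : ℂ := ∑' j : ℕ, ((a j / j : ℝ) : ℂ) * z ^ j

/-- The radius of convergence of `g_a`. -/
def radius (a : ℕ → ℝ) : ℝ≥0∞ :=
  (FormalMultilinearSeries.ofScalars ℂ fun j : ℕ => ((a j / j : ℝ) : ℂ)).radius

/-- The modified derivative `g_a^{n}(r) = r^n (d/dr)^n g_a(r)` of a generating function with
nonnegative coefficients at `r ∈ [0, R]`, as the (possibly divergent) series
`∑_j j (j-1) ⋯ (j-n+1) (a_j / j) r^j` of nonnegative terms. At `r = R` (also for `R = ∞`), this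
is the limit of the values as `r ↑ R`, by monotone convergence. -/
def modDeriv (a : ℕ → ℝ) (n : ℕ) (r : ℝ≥0∞) : ℝ≥0∞ :=
  ∑' j : ℕ, ENNReal.ofReal ((j.descFactorial n : ℝ) * (a j / j)) * r ^ j

/-- The sequence is non-arithmetic (no `d > 1` divides all `j` with `κ_j ≠ 0`) and non-degenerate
(`κ_j > 0` for some `j ≥ 2`). -/
structure NonArithmetic (κ : ℕ → ℝ) : Prop where
  nonArith : ¬ ∃ d : ℕ, 1 < d ∧ ∀ j : ℕ, 1 ≤ j → κ j ≠ 0 → d ∣ j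
  nondegenerate : ∃ j : ℕ, 2 ≤ j ∧ 0 < κ j

/-- `r` is the point `r_*`: the root of `g_κ^{1}(r) = 1` in `(0, R]` if `g_κ^{1}(R) ≥ 1`, and
`R` if `g_κ^{1}(R) ≤ 1`. -/
structure IsRStar (κ : ℕ → ℝ) (r : ℝ) : Prop where
  pos : 0 < r
  le_radius : ENNReal.ofReal r ≤ radius κ
  root : 1 ≤ modDeriv κ 1 (radius κ) → modDeriv κ 1 (ENNReal.ofReal r) = 1
  boundary : modDeriv κ 1 (radius κ) ≤ 1 → ENNReal.ofReal r = radius κ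

/-- The indented disk `Δ₀(R, η, φ)`. -/
def deltaDomain (R η φ : ℝ) : Set ℂ :=
  {z | ‖z‖ < ‖(R : ℂ) * (1 + η * Complex.exp (Complex.I * φ))‖ ∧ z ≠ R ∧
    φ < |Complex.arg (z - R)|}

/-- `G` is a holomorphic extension to `D` of the generating function `g_a`, whose series converges
for `|z| < R`. -/
structure Continues (a : ℕ → ℝ) (R : ℝ) (D : Set ℂ) (G : ℂ → ℂ) : Prop where
  le_radius : ENNReal.ofReal R ≤ radius a
  holo : DifferentiableOn ℂ G D
  eq_genFun : ∀ z : ℂ, ‖z‖ < R → G z = genFun a z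

/-- The value `g_κ^{n}(R)` as a real number (used only where it is finite). -/
def bdryVal (κ : ℕ → ℝ) (n : ℕ) (R : ℝ) : ℝ := (modDeriv κ n (ENNReal.ofReal R)).toReal

/-- `G(z) = -θ* log (1 - z/R) + O((1 - z/R)^δ)` as `z → R` in `D`. -/
def LogExpansion (R : ℝ) (D : Set ℂ) (G : ℂ → ℂ) (θs δ : ℝ) : Prop :=
  (fun z : ℂ => G z + θs * Complex.log (1 - z / R)) =O[𝓝[D] (R : ℂ)]
    fun z => ‖1 - z / R‖ ^ δ

/-! ### The asymptotic regimes -/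

/-- Subcritical case, `R ≤ ∞`. -/
def Subcritical (θ κ : ℕ → ℝ) : Prop :=
  0 < radius κ ∧ radius κ ≤ radius θ ∧ 1 < modDeriv κ 1 (radius κ)

/-- Supercritical case with a logarithmic singularity of `g_θ`. -/
def SupercriticalLog (θ κ : ℕ → ℝ) : Prop :=
  ∃ R η φ θs δ : ℝ, ∃ Gθ Gκ : ℂ → ℂ,
    0 < R ∧ radius κ = ENNReal.ofReal R ∧ 0 < η ∧ 0 < φ ∧ φ < Real.pi / 2 ∧
    0 < θs ∧ 0 < δ ∧
    modDeriv κ 1 (ENNReal.ofReal R) < 1 ∧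
    Continues θ R (deltaDomain R η φ) Gθ ∧
    Continues κ R (deltaDomain R η φ) Gκ ∧
    LogExpansion R (deltaDomain R η φ) Gθ θs δ ∧
    (fun z : ℂ => Gκ z - (bdryVal κ 0 R - bdryVal κ 1 R * (1 - z / R)))
      =O[𝓝[deltaDomain R η φ] (R : ℂ)] fun z => ‖1 - z / R‖ ^ (1 + δ)

/-- Supercritical case with `g_θ` regular at `R` and a power singularity of `g_κ`. -/
def SupercriticalPower (θ κ : ℕ → ℝ) : Prop :=
  ∃ R η φ s as δ : ℝ, ∃ Gθ Gκ : ℂ → ℂ,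
    0 < R ∧ radius κ = ENNReal.ofReal R ∧ 0 < η ∧ 0 < φ ∧ φ < Real.pi / 2 ∧
    1 < s ∧ (∀ n : ℕ, s ≠ n) ∧ as ≠ 0 ∧ 0 < δ ∧
    modDeriv κ 1 (ENNReal.ofReal R) < 1 ∧
    (∀ n : ℕ, (n : ℝ) < s → modDeriv κ n (ENNReal.ofReal R) < ∞) ∧
    (∀ n : ℕ, s < n → modDeriv κ n (ENNReal.ofReal R) = ∞) ∧
    Continues θ R (deltaDomain R η φ) Gθ ∧ AnalyticAt ℂ Gθ R ∧
    Continues κ R (deltaDomain R η φ) Gκ ∧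
    (fun z : ℂ => Gκ z - (∑ n ∈ Finset.range ⌈s⌉₊,
        (-1) ^ n * (bdryVal κ n R : ℂ) / (n.factorial : ℂ) * (1 - z / R) ^ n
        + as * (1 - z / R) ^ (s : ℂ)))
      =O[𝓝[deltaDomain R η φ] (R : ℂ)] fun z => ‖1 - z / R‖ ^ (s + δ)

/-- Critical case with `g_θ(R) < ∞` and `g_κ^{2}(R) < ∞`. -/
def CriticalRegular (θ κ : ℕ → ℝ) : Prop :=
  ∃ R : ℝ, 0 < R ∧ radius κ = ENNReal.ofReal R ∧ ENNReal.ofReal R ≤ radius θ ∧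
    modDeriv θ 0 (ENNReal.ofReal R) < ∞ ∧
    modDeriv κ 0 (ENNReal.ofReal R) < ∞ ∧
    modDeriv κ 1 (ENNReal.ofReal R) = 1 ∧
    0 < modDeriv κ 2 (ENNReal.ofReal R) ∧ modDeriv κ 2 (ENNReal.ofReal R) < ∞

/-- Critical case, `g_θ` possibly with a logarithmic singularity, `g_κ^{2}(R) < ∞`. -/
def CriticalLog (θ κ : ℕ → ℝ) : Prop :=
  ∃ R η φ θs δ : ℝ, ∃ Gθ Gκ : ℂ → ℂ,
    0 < R ∧ radius κ = ENNReal.ofReal R ∧ 0 < η ∧ 0 < φ ∧ φ < Real.pi / 2 ∧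
    0 ≤ θs ∧ 0 < δ ∧
    modDeriv κ 1 (ENNReal.ofReal R) = 1 ∧
    0 < modDeriv κ 2 (ENNReal.ofReal R) ∧ modDeriv κ 2 (ENNReal.ofReal R) < ∞ ∧
    Continues θ R (deltaDomain R η φ) Gθ ∧
    Continues κ R (deltaDomain R η φ) Gκ ∧
    LogExpansion R (deltaDomain R η φ) Gθ θs δ ∧
    (fun z : ℂ => Gκ z - (bdryVal κ 0 R - (1 - z / R)
        + bdryVal κ 2 R / 2 * (1 - z / R) ^ 2))
      =O[𝓝[deltaDomain R η φ] (R : ℂ)] fun z => ‖1 - z / R‖ ^ (2 + δ)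

/-- Critical case, `g_θ` possibly with a logarithmic singularity, `g_κ` with a power singularity
of order `s ∈ (1, 2)`. -/
def CriticalPower (θ κ : ℕ → ℝ) : Prop :=
  ∃ R η φ θs s as δ : ℝ, ∃ Gθ Gκ : ℂ → ℂ,
    0 < R ∧ radius κ = ENNReal.ofReal R ∧ 0 < η ∧ 0 < φ ∧ φ < Real.pi / 2 ∧
    0 ≤ θs ∧ 1 < s ∧ s < 2 ∧ 0 < as ∧ 0 < δ ∧
    modDeriv κ 1 (ENNReal.ofReal R) = 1 ∧
    Continues θ R (deltaDomain R η φ) Gθ ∧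
    Continues κ R (deltaDomain R η φ) Gκ ∧
    LogExpansion R (deltaDomain R η φ) Gθ θs δ ∧
    (fun z : ℂ => Gκ z - (bdryVal κ 0 R - (1 - z / R) + as * (1 - z / R) ^ (s : ℂ)))
      =O[𝓝[deltaDomain R η φ] (R : ℂ)] fun z => ‖1 - z / R‖ ^ (s + δ)

/-- The standing assumption on the generating functions: one of the six regimes. -/
def Admissible (θ κ : ℕ → ℝ) : Prop :=
  Subcritical θ κ ∨ SupercriticalLog θ κ ∨ SupercriticalPower θ κ ∨
    CriticalRegular θ κ ∨ CriticalLog θ κ ∨ CriticalPower θ κ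

end

end SurrogateSpatial

/-!
Let `Z_M` be the coefficient of `z^M` in `exp (∑_j x_j z^j)` with `x_j = (θ_j + N κ_j) / j`. The
joint factorial moment of order `(n_j)` of the cycle counts is `∏_j x_j^{n_j}` times
`Z_{N-k} / Z_N`, where `k = ∑_j j n_j`, so everything rests on `Z_{N-k} / Z_N → r_*^k`.

The mean number of parts `i` under the partition weights is `x_i Z_{N-i} / Z_N`. Multiplying `x_i`
by `e^t` and applying Jensen's inequality bounds this mean by the difference of an upper and a
lower bound for `log Z`. The upper bound is `Z_N ρ^N ≤ exp (∑_j x_j ρ^j)` with `ρ < r_*` close to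
`r_*`. The lower bound `Z_N r_*^N ≥ exp (N (g_κ(r_*) - ε))` comes from a single typical partition,
with about `N κ_j r_*^j / j` parts `j`. Such parts have total size `N g_κ^{1}(r_*)`; when this is
less than `N`, the point `r_*` is the radius of convergence, `κ_i r_*^i` is not exponentially
small in `i`, and the missing size is filled with equal parts `i` at negligible cost. Taking both
signs of `t` gives `Z_{N-i} / Z_N → r_*^i` whenever `κ_i > 0`, and hence for all `i`, because the
indices with `κ_i > 0` have greatest common divisor `1`.

If `κ_j > 0`, the variance of `C_j / N` tends to `0`; if `κ_j = 0`, Bonferroni's inequalities turn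
the convergence of the factorial moments of `C_j` into a Poisson limit.
-/

namespace SurrogateSpatial

/-! ### Weighted sums over partitions -/

/-- The weight `∏_j x_j^{c_j} / c_j!` of a multiset in which `j` occurs `c_j` times. -/
noncomputable def partWeight (x : ℕ → ℝ) (s : Multiset ℕ) : ℝ :=
  ∏ j ∈ s.toFinset, x j ^ s.count j / ((s.count j).factorial : ℝ)

/-- The partition function: the total weight of the partitions of `M`, which is the coefficient of
`z^M` in `exp (∑_j x_j z^j)`. -/
noncomputable def partSum (x : ℕ → ℝ) (M : ℕ) : ℝ :=
  ∑ p : M.Partition, partWeight x p.parts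

/-- The multiset in which each `j ∈ T` occurs `n j` times. -/
def multisetOfCounts (T : Finset ℕ) (n : ℕ → ℕ) : Multiset ℕ :=
  ∑ j ∈ T, Multiset.replicate (n j) j

lemma count_multisetOfCounts (T : Finset ℕ) (n : ℕ → ℕ) (i : ℕ) :
    (multisetOfCounts T n).count i = if i ∈ T then n i else 0 := by
  simp [multisetOfCounts, Multiset.count_sum', Multiset.count_replicate]

lemma sum_multisetOfCounts (T : Finset ℕ) (n : ℕ → ℕ) :
    (multisetOfCounts T n).sum = ∑ j ∈ T, n j * j := by
  simp [multisetOfCounts, Multiset.sum_sum]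

lemma mem_of_mem_multisetOfCounts {T : Finset ℕ} {n : ℕ → ℕ} {i : ℕ}
    (hi : i ∈ multisetOfCounts T n) : i ∈ T := by
  rw [← Multiset.count_pos, count_multisetOfCounts] at hi
  by_contra h
  simp [h] at hi

lemma partWeight_eq_prod (x : ℕ → ℝ) {s : Multiset ℕ} {T : Finset ℕ} (h : s.toFinset ⊆ T) :
    partWeight x s = ∏ j ∈ T, x j ^ s.count j / ((s.count j).factorial : ℝ) := by
  refine Finset.prod_subset h fun j _ hj => ?_
  rw [Multiset.mem_toFinset] at hj
  simp [Multiset.count_eq_zero_of_notMem hj]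

lemma partWeight_mul (x y : ℕ → ℝ) (s : Multiset ℕ) :
    partWeight (x * y) s = partWeight x s * (s.map y).prod := by
  rw [partWeight, partWeight, Finset.prod_multiset_map_count, ← Finset.prod_mul_distrib]
  refine Finset.prod_congr rfl fun j _ => ?_
  rw [Pi.mul_apply, mul_pow]
  ring

lemma partWeight_replicate (x : ℕ → ℝ) (k i : ℕ) :
    partWeight x (Multiset.replicate k i) = x i ^ k / (k.factorial : ℝ) := by
  have h : (Multiset.replicate k i).toFinset ⊆ {i} := fun j hj => by
    rw [Multiset.mem_toFinset] at hj
    exact Finset.mem_singleton.2 (Multiset.eq_of_mem_replicate hj)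
  rw [partWeight_eq_prod x h, Finset.prod_singleton, Multiset.count_replicate_self]

lemma partWeight_add_of_disjoint (x : ℕ → ℝ) {s t : Multiset ℕ} (h : Disjoint s t) :
    partWeight x (s + t) = partWeight x s * partWeight x t := by
  classical
  rw [partWeight, Multiset.toFinset_add, Finset.prod_union (Multiset.disjoint_toFinset.2 h)]
  congr 1 <;> refine Finset.prod_congr rfl fun j hj => ?_ <;> rw [Multiset.mem_toFinset] at hj <;>
    rw [Multiset.count_add]
  · rw [Multiset.count_eq_zero_of_notMem (Multiset.disjoint_left.1 h hj), add_zero]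
  · rw [Multiset.count_eq_zero_of_notMem (Multiset.disjoint_right.1 h hj), zero_add]

lemma partWeight_multisetOfCounts (x : ℕ → ℝ) (T : Finset ℕ) (n : ℕ → ℕ) :
    partWeight x (multisetOfCounts T n) = ∏ j ∈ T, x j ^ n j / ((n j).factorial : ℝ) := by
  rw [partWeight_eq_prod x fun i hi => mem_of_mem_multisetOfCounts (Multiset.mem_toFinset.1 hi)]
  refine Finset.prod_congr rfl fun j hj => ?_
  rw [count_multisetOfCounts, if_pos hj]

lemma partWeight_add_multisetOfCounts_mul_descFactorial (x : ℕ → ℝ) (s : Multiset ℕ)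
    (T : Finset ℕ) (n : ℕ → ℕ) :
    partWeight x (s + multisetOfCounts T n) *
        ∏ j ∈ T, (((s + multisetOfCounts T n).count j).descFactorial (n j) : ℝ) =
      (∏ j ∈ T, x j ^ n j) * partWeight x s := by
  classical
  set m := multisetOfCounts T n
  have hsm : (s + m).toFinset ⊆ s.toFinset ∪ T := by
    rw [Multiset.toFinset_add]
    exact Finset.union_subset_union_right fun i hi =>
      mem_of_mem_multisetOfCounts (Multiset.mem_toFinset.1 hi)
  have extend (f : ℕ → ℝ) : ∏ j ∈ T, f j = ∏ j ∈ s.toFinset ∪ T, if j ∈ T then f j else 1 := by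
    rw [Finset.prod_ite_mem, Finset.inter_eq_right.2 Finset.subset_union_right]
  rw [partWeight_eq_prod x hsm, partWeight_eq_prod x (s := s) Finset.subset_union_left, extend,
    extend, ← Finset.prod_mul_distrib, ← Finset.prod_mul_distrib]
  refine Finset.prod_congr rfl fun j _ => ?_
  rw [Multiset.count_add, count_multisetOfCounts]
  split_ifs with hj
  · rw [← Nat.factorial_mul_descFactorial (Nat.le_add_left (n j) (s.count j)),
      Nat.add_sub_cancel, pow_add]
    have : ((s.count j + n j).descFactorial (n j) : ℝ) ≠ 0 := by
      rw [Nat.cast_ne_zero, Ne, Nat.descFactorial_eq_zero_iff_lt]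
      omega
    push_cast
    field_simp
  · simp

section Partition

variable {M : ℕ} (p : M.Partition)

lemma partition_toFinset_subset : p.parts.toFinset ⊆ Finset.Icc 1 M := fun j hj => by
  rw [Multiset.mem_toFinset] at hj
  exact Finset.mem_Icc.2 ⟨p.parts_pos hj, p.le_of_mem_parts hj⟩

lemma count_mul_le (j : ℕ) : p.parts.count j * j ≤ M := by
  obtain ⟨u, hu⟩ := Multiset.le_iff_exists_add.1
    (Multiset.le_count_iff_replicate_le.1 (le_refl (p.parts.count j)))
  have h := congrArg Multiset.sum hu
  rw [p.parts_sum, Multiset.sum_add, Multiset.sum_replicate, smul_eq_mul] at h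
  omega

end Partition

section Nonneg

variable {x : ℕ → ℝ} (hx : ∀ j, 0 ≤ x j)
include hx

lemma partWeight_nonneg (s : Multiset ℕ) : 0 ≤ partWeight x s :=
  Finset.prod_nonneg fun j _ => div_nonneg (pow_nonneg (hx j) _) (Nat.cast_nonneg _)

lemma partSum_nonneg (M : ℕ) : 0 ≤ partSum x M :=
  Finset.sum_nonneg fun p _ => partWeight_nonneg hx p.parts

lemma prod_pow_div_factorial_le_partSum {T : Finset ℕ} (hT : ∀ j ∈ T, 1 ≤ j) (n : ℕ → ℕ) :
    ∏ j ∈ T, x j ^ n j / ((n j).factorial : ℝ) ≤ partSum x (∑ j ∈ T, n j * j) := by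
  let p : (∑ j ∈ T, n j * j).Partition :=
    ⟨multisetOfCounts T n, fun hi => hT _ (mem_of_mem_multisetOfCounts hi),
      sum_multisetOfCounts T n⟩
  rw [← partWeight_multisetOfCounts]
  exact Finset.single_le_sum (f := fun p : (∑ j ∈ T, n j * j).Partition => partWeight x p.parts)
    (fun p _ => partWeight_nonneg hx p.parts) (Finset.mem_univ p)

lemma partSum_le_exp (M : ℕ) : partSum x M ≤ Real.exp (∑ j ∈ Finset.Icc 1 M, x j) := by
  classical
  let counts (p : M.Partition) : ∀ j ∈ Finset.Icc 1 M, ℕ := fun j _ => p.parts.count j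
  have counts_injective : Function.Injective counts := fun p q h => by
    refine Nat.Partition.ext (Multiset.ext.2 fun j => ?_)
    by_cases hj : j ∈ Finset.Icc 1 M
    · exact congrFun (congrFun h j) hj
    · rw [Multiset.count_eq_zero_of_notMem, Multiset.count_eq_zero_of_notMem] <;>
        exact fun h => hj (partition_toFinset_subset _ (Multiset.mem_toFinset.2 h))
  have counts_mem (p : M.Partition) :
      counts p ∈ (Finset.Icc 1 M).pi fun _ => Finset.range (M + 1) :=
    Finset.mem_pi.2 fun j hj => Finset.mem_range_succ_iff.2
      ((Nat.le_mul_of_pos_right _ (Finset.mem_Icc.1 hj).1).trans (count_mul_le p j))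
  calc partSum x M
      = ∑ c ∈ Finset.univ.image counts, ∏ j ∈ (Finset.Icc 1 M).attach,
          x j ^ c j j.2 / ((c j j.2).factorial : ℝ) := by
        rw [Finset.sum_image counts_injective.injOn]
        refine Finset.sum_congr rfl fun p _ => ?_
        rw [partWeight_eq_prod x (partition_toFinset_subset p), ← Finset.prod_attach]
    _ ≤ ∏ j ∈ Finset.Icc 1 M, ∑ c ∈ Finset.range (M + 1), x j ^ c / (c.factorial : ℝ) := by
        rw [Finset.prod_sum]
        refine Finset.sum_le_sum_of_subset_of_nonneg
          (Finset.image_subset_iff.2 fun p _ => counts_mem p) fun c _ _ => ?_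
        exact Finset.prod_nonneg fun j _ => div_nonneg (pow_nonneg (hx j) _) (Nat.cast_nonneg _)
    _ ≤ Real.exp (∑ j ∈ Finset.Icc 1 M, x j) := by
        rw [Real.exp_sum]
        refine Finset.prod_le_prod (fun j _ => Finset.sum_nonneg fun c _ => ?_)
          fun j _ => Real.sum_le_exp_of_nonneg (hx j) _
        exact div_nonneg (pow_nonneg (hx j) _) (Nat.cast_nonneg _)

end Nonneg

lemma partSum_mul_pow (x : ℕ → ℝ) (r : ℝ) (M : ℕ) :
    partSum (x * fun j => r ^ j) M = partSum x M * r ^ M := by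
  have prod_map_pow (s : Multiset ℕ) : (s.map (r ^ ·)).prod = r ^ s.sum := by
    induction s using Multiset.induction_on with
    | empty => simp
    | cons j s ih => rw [Multiset.map_cons, Multiset.prod_cons, ih, Multiset.sum_cons, pow_add]
  simp_rw [partSum, partWeight_mul, Finset.sum_mul, prod_map_pow, Nat.Partition.parts_sum]

lemma sum_partWeight_mul_pow_count (x : ℕ → ℝ) (a : ℝ) (i M : ℕ) :
    ∑ p : M.Partition, partWeight x p.parts * a ^ p.parts.count i =
      partSum (Function.update x i (x i * a)) M := by
  have update_eq : Function.update x i (x i * a) = x * Function.update (1 : ℕ → ℝ) i a := by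
    ext j
    by_cases h : j = i <;> simp [h]
  simp_rw [update_eq, partSum, partWeight_mul]
  refine Finset.sum_congr rfl fun p _ => ?_
  rw [Finset.prod_multiset_map_count, Finset.prod_eq_single i] <;> simp +contextual

lemma sum_partWeight_mul_prod_descFactorial (x : ℕ → ℝ) {T : Finset ℕ} (hT : ∀ j ∈ T, 1 ≤ j)
    (n : ℕ → ℕ) (M : ℕ) :
    ∑ p : (M + ∑ j ∈ T, n j * j).Partition, partWeight x p.parts *
        ∏ j ∈ T, ((p.parts.count j).descFactorial (n j) : ℝ) =
      (∏ j ∈ T, x j ^ n j) * partSum x M := by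
  classical
  set m := multisetOfCounts T n with hm
  let add (q : M.Partition) : (M + ∑ j ∈ T, n j * j).Partition :=
    ⟨q.parts + m, fun hi => (Multiset.mem_add.1 hi).elim (fun h => q.parts_pos h)
      fun h => hT _ (mem_of_mem_multisetOfCounts h),
      by rw [Multiset.sum_add, q.parts_sum, sum_multisetOfCounts]⟩
  have add_injective : Function.Injective add := fun p q h =>
    Nat.Partition.ext (add_right_cancel (congrArg Nat.Partition.parts h))
  have mem_range_add {p : (M + ∑ j ∈ T, n j * j).Partition} (hp : m ≤ p.parts) :
      p ∈ Set.range add := by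
    have hsum := congrArg Multiset.sum (Multiset.sub_add_cancel hp)
    rw [Multiset.sum_add, p.parts_sum, sum_multisetOfCounts] at hsum
    exact ⟨⟨p.parts - m, fun hi => p.parts_pos (Multiset.mem_of_le tsub_le_self hi), by omega⟩,
      Nat.Partition.ext (Multiset.sub_add_cancel hp)⟩
  rw [partSum, Finset.mul_sum]
  refine (Fintype.sum_of_injective add add_injective _ _ (fun p hp => ?_) fun q => ?_).symm
  · obtain ⟨j, hj⟩ := not_forall.1 fun h => hp (mem_range_add (Multiset.le_iff_count.2 h))
    rw [hm, count_multisetOfCounts] at hj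
    split_ifs at hj with hjT
    · rw [Finset.prod_eq_zero hjT, mul_zero]
      rw [Nat.descFactorial_of_lt (not_le.1 hj), Nat.cast_zero]
    · exact absurd (Nat.zero_le _) hj
  · exact (partWeight_add_multisetOfCounts_mul_descFactorial x q.parts T n).symm

/-! ### From permutations to partitions -/

section CycleType

variable {N : ℕ} (p : N.Partition)

lemma parts_eq_filter_add_replicate :
    p.parts = p.parts.filter (2 ≤ ·) +
      Multiset.replicate (N - (p.parts.filter (2 ≤ ·)).sum) 1 := by
  have ones : p.parts.filter (fun n => ¬ 2 ≤ n) =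
      Multiset.replicate (p.parts.filter (fun n => ¬ 2 ≤ n)).card 1 := by
    refine Multiset.eq_replicate_card.2 fun b hb => ?_
    rw [Multiset.mem_filter] at hb
    have := p.parts_pos hb.1
    omega
  have split := Multiset.filter_add_not (2 ≤ ·) p.parts
  have hsum := congrArg Multiset.sum split
  rw [Multiset.sum_add, p.parts_sum, ones, Multiset.sum_replicate, smul_eq_mul, mul_one] at hsum
  conv_lhs => rw [← split, ones]
  congr 2
  omega

lemma partition_parts_eq_iff_cycleType_eq (σ : Equiv.Perm (Fin N)) :
    σ.partition.parts = p.parts ↔ σ.cycleType = p.parts.filter (2 ≤ ·) := by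
  refine ⟨fun h => ?_, fun h => ?_⟩
  · rw [← Equiv.Perm.filter_parts_partition_eq_cycleType, h]
  · conv_rhs => rw [parts_eq_filter_add_replicate p]
    rw [Equiv.Perm.parts_partition, ← Equiv.Perm.sum_cycleType, h, Fintype.card_fin]

lemma partWeight_one_div_mul {s : Multiset ℕ} (hs : 0 ∉ s) :
    partWeight (fun j => 1 / (j : ℝ)) s *
      ((s.prod * ∏ j ∈ s.toFinset, (s.count j).factorial : ℕ) : ℝ) = 1 := by
  rw [partWeight, Finset.prod_multiset_count s, ← Finset.prod_mul_distrib, Nat.cast_prod,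
    ← Finset.prod_mul_distrib]
  refine Finset.prod_eq_one fun j hj => ?_
  have : (j : ℝ) ≠ 0 := Nat.cast_ne_zero.2 fun h => hs (h ▸ Multiset.mem_toFinset.1 hj)
  push_cast
  rw [div_pow, one_pow]
  field_simp

lemma card_filter_partition_parts_eq :
    ((Finset.univ.filter fun σ : Equiv.Perm (Fin N) => σ.partition.parts = p.parts).card : ℝ) =
      N.factorial * partWeight (fun j => 1 / (j : ℝ)) p.parts := by
  set m := p.parts.filter (2 ≤ ·) with hm
  have two_le {j : ℕ} (hj : j ∈ m) : 2 ≤ j := (Multiset.mem_filter.1 hj).2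
  have hp : p.parts = m + Multiset.replicate (N - m.sum) 1 := parts_eq_filter_add_replicate p
  have hmN : m.sum ≤ N := by
    have h := congrArg Multiset.sum hp
    rw [p.parts_sum, Multiset.sum_add] at h
    omega
  have disjoint : Disjoint m (Multiset.replicate (N - m.sum) 1) :=
    Multiset.disjoint_left.2 fun hj hj' => by
      have := two_le hj
      have := Multiset.eq_of_mem_replicate hj'
      omega
  have weight : partWeight (fun j => 1 / (j : ℝ)) p.parts *
      (((N - m.sum).factorial * m.prod * ∏ j ∈ m.toFinset, (m.count j).factorial : ℕ) : ℝ) = 1 := by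
    have h := partWeight_one_div_mul (s := m) fun h => by have := two_le h; omega
    rw [hp, partWeight_add_of_disjoint _ disjoint, partWeight_replicate, mul_assoc, Nat.cast_mul]
    push_cast at h ⊢
    field_simp
    rw [one_pow]
    linear_combination h
  have card := Equiv.Perm.card_of_cycleType_mul_eq (Fin N) m
  simp_rw [Fintype.card_fin, hm, ← partition_parts_eq_iff_cycleType_eq, ← hm] at card
  rw [if_pos ⟨hmN, fun _ => two_le⟩] at card
  rw [← card, Nat.cast_mul, mul_assoc, mul_comm _ (partWeight _ _), weight, mul_one]

end CycleType

/-- The parameters `(θ_j + N κ_j) / j` for which the weights of partitions are, up to the factor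
`N!`, the total weights of the corresponding classes of permutations. -/
noncomputable def cycleParam (θ κ : ℕ → ℝ) (N j : ℕ) : ℝ := (θ j + N * κ j) / j

lemma cycleWeight_eq_prod_map (θ κ : ℕ → ℝ) {N : ℕ} (σ : Equiv.Perm (Fin N)) :
    cycleWeight θ κ N σ = (σ.partition.parts.map fun j => θ j + N * κ j).prod := by
  rw [cycleWeight, Finset.prod_multiset_map_count]
  refine (Finset.prod_subset (fun j hj => ?_) fun j _ hj => ?_).symm
  · simpa using partition_toFinset_subset _ hj
  · rw [cycleCount, Multiset.count_eq_zero_of_notMem fun h => hj (Multiset.mem_toFinset.2 h),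
      pow_zero]

lemma sum_cycleWeight_mul (θ κ : ℕ → ℝ) (N : ℕ) (F : Multiset ℕ → ℝ) :
    ∑ σ : Equiv.Perm (Fin N), cycleWeight θ κ N σ * F σ.partition.parts =
      N.factorial * ∑ p : N.Partition, partWeight (cycleParam θ κ N) p.parts * F p.parts := by
  classical
  have cycleParam_eq : cycleParam θ κ N = (fun j : ℕ => 1 / (j : ℝ)) * fun j => θ j + N * κ j := by
    ext j
    simp only [cycleParam, Pi.mul_apply]
    ring
  let toPartition (σ : Equiv.Perm (Fin N)) : N.Partition :=
    ⟨σ.partition.parts, fun h => σ.partition.parts_pos h, by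
      rw [σ.partition.parts_sum, Fintype.card_fin]⟩
  have toPartition_eq_iff (σ p) : toPartition σ = p ↔ σ.partition.parts = p.parts :=
    Nat.Partition.ext_iff
  rw [← Finset.sum_fiberwise Finset.univ toPartition, Finset.mul_sum]
  refine Finset.sum_congr rfl fun p _ => ?_
  calc ∑ σ with toPartition σ = p, cycleWeight θ κ N σ * F σ.partition.parts
      = ∑ σ with toPartition σ = p, (p.parts.map fun j => θ j + N * κ j).prod * F p.parts := by
        refine Finset.sum_congr rfl fun σ hσ => ?_
        rw [Finset.mem_filter, toPartition_eq_iff] at hσ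
        rw [cycleWeight_eq_prod_map, hσ.2]
    _ = _ := by
        simp_rw [Finset.sum_const, nsmul_eq_mul, toPartition_eq_iff]
        rw [card_filter_partition_parts_eq, cycleParam_eq, partWeight_mul]
        ring

lemma normConst_eq_partSum (θ κ : ℕ → ℝ) (N : ℕ) :
    normConst θ κ N = partSum (cycleParam θ κ N) N := by
  have h := sum_cycleWeight_mul θ κ N fun _ => 1
  simp only [mul_one] at h
  rw [normConst, h, partSum]
  field_simp

lemma expect_eq_sum_div_partSum (θ κ : ℕ → ℝ) (N : ℕ) (F : Multiset ℕ → ℝ) :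
    expect θ κ N (fun σ => F σ.partition.parts) =
      (∑ p : N.Partition, partWeight (cycleParam θ κ N) p.parts * F p.parts) /
        partSum (cycleParam θ κ N) N := by
  simp_rw [expect, permProb, div_mul_eq_mul_div]
  rw [← Finset.sum_div, sum_cycleWeight_mul, normConst_eq_partSum,
    mul_div_mul_left _ _ (Nat.cast_ne_zero.2 N.factorial_ne_zero)]

lemma expect_prod_descFactorial (θ κ : ℕ → ℝ) {T : Finset ℕ} (hT : ∀ j ∈ T, 1 ≤ j)
    (n : ℕ → ℕ) {N : ℕ} (hN : ∑ j ∈ T, n j * j ≤ N) :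
    expect θ κ N (fun σ => ∏ j ∈ T, ((cycleCount j σ).descFactorial (n j) : ℝ)) =
      (∏ j ∈ T, cycleParam θ κ N j ^ n j) *
        (partSum (cycleParam θ κ N) (N - ∑ j ∈ T, n j * j) / partSum (cycleParam θ κ N) N) := by
  simp only [cycleCount]
  rw [expect_eq_sum_div_partSum θ κ N fun s => ∏ j ∈ T, ((s.count j).descFactorial (n j) : ℝ),
    ← mul_div_assoc]
  congr 1
  obtain ⟨M, rfl⟩ := Nat.exists_eq_add_of_le' hN
  rw [Nat.add_sub_cancel]
  exact sum_partWeight_mul_prod_descFactorial _ hT n M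

/-! ### Exponential lower bound -/

/-- The indices `j ≥ 1` at which `a` is positive. -/
def posIndices (a : ℕ → ℝ) : Set ℕ := {j | 1 ≤ j ∧ 0 < a j}

/-- The parameters `x` are nonnegative and at least `N c_j`. The sequence `c` is the density of the
typical partitions of `N`, which have about `N c_j` parts `j`. -/
structure Dominates (c : ℕ → ℝ) (N : ℕ) (x : ℕ → ℝ) : Prop where
  nonneg : ∀ j, 0 ≤ x j
  le : ∀ j, N * c j ≤ x j

/-- The exponential cost, per unit of size, of enlarging partitions by parts `i` only: each of these
parts multiplies the lower bound on the partition function by `i c_i`. -/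
noncomputable def fillRate (c : ℕ → ℝ) (i : ℕ) : ℝ := -Real.log (i * c i) / i

lemma sum_partWeight_mul_count (x : ℕ → ℝ) {j : ℕ} (hj : 1 ≤ j) (M : ℕ) :
    ∑ p : (M + j).Partition, partWeight x p.parts * p.parts.count j = x j * partSum x M := by
  have h := sum_partWeight_mul_prod_descFactorial x (T := {j}) (by simpa using hj) (fun _ => 1) M
  rw [Finset.sum_singleton, one_mul] at h
  simpa only [Finset.prod_singleton, Nat.descFactorial_one, pow_one] using h

lemma mul_partSum_le_mul_partSum_add {x : ℕ → ℝ} (hx : ∀ j, 0 ≤ x j) {j : ℕ} (hj : 1 ≤ j)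
    (M : ℕ) : j * x j * partSum x M ≤ (M + j : ℕ) * partSum x (M + j) := by
  rw [mul_assoc, ← sum_partWeight_mul_count x hj, partSum, Finset.mul_sum, Finset.mul_sum]
  refine Finset.sum_le_sum fun p _ => ?_
  have hcount : (p.parts.count j : ℝ) * j ≤ (M + j : ℕ) := mod_cast count_mul_le p j
  calc (j : ℝ) * (partWeight x p.parts * p.parts.count j)
      = p.parts.count j * j * partWeight x p.parts := by ring
    _ ≤ (M + j : ℕ) * partWeight x p.parts :=
        mul_le_mul_of_nonneg_right hcount (partWeight_nonneg hx _)

namespace Dominates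

variable {c : ℕ → ℝ} {N : ℕ} {x : ℕ → ℝ}

lemma partSum_add (h : Dominates c N x) {j : ℕ} (hj : 1 ≤ j) {M : ℕ} (hM : M + j ≤ N) :
    j * c j * partSum x M ≤ partSum x (M + j) := by
  have hN : (0 : ℝ) < N := by norm_cast; omega
  have hMN : ((M + j : ℕ) : ℝ) ≤ N := mod_cast hM
  refine le_of_mul_le_mul_left ?_ hN
  calc (N : ℝ) * (j * c j * partSum x M)
      = j * (N * c j) * partSum x M := by ring
    _ ≤ j * x j * partSum x M := by
        have := h.le j
        have := partSum_nonneg h.nonneg M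
        gcongr
    _ ≤ (M + j : ℕ) * partSum x (M + j) := mul_partSum_le_mul_partSum_add h.nonneg hj M
    _ ≤ N * partSum x (M + j) := mul_le_mul_of_nonneg_right hMN (partSum_nonneg h.nonneg _)

lemma pow_mul_partSum_le (h : Dominates c N x) {j : ℕ} (hj : 1 ≤ j) (hc : 0 ≤ c j) (q : ℕ)
    {M : ℕ} (hM : M + q * j ≤ N) : (j * c j) ^ q * partSum x M ≤ partSum x (M + q * j) := by
  induction q with
  | zero => simp
  | succ q ih =>
    rw [add_mul, one_mul, ← add_assoc] at hM ⊢
    rw [pow_succ', mul_assoc]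
    exact (mul_le_mul_of_nonneg_left (ih (by omega)) (by positivity)).trans (h.partSum_add hj hM)

lemma smul (h : Dominates c N x) (hc : ∀ j, 0 ≤ c j) {a : ℝ} (ha : a ≤ 1) :
    Dominates (fun j => a * c j) N x :=
  ⟨h.nonneg, fun j => le_trans
    (mul_le_mul_of_nonneg_left (mul_le_of_le_one_left (hc j) ha) N.cast_nonneg) (h.le j)⟩

end Dominates

lemma exists_const_mul_partSum_le_of_mem_closure {c : ℕ → ℝ} {s : ℕ}
    (hs : s ∈ AddSubmonoid.closure (posIndices c)) :
    ∃ C : ℝ, 0 < C ∧ ∀ (N : ℕ) (x : ℕ → ℝ), Dominates c N x → ∀ M, M + s ≤ N →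
      C * partSum x M ≤ partSum x (M + s) := by
  induction hs using AddSubmonoid.closure_induction with
  | mem j hj =>
    exact ⟨j * c j, mul_pos (Nat.cast_pos.2 hj.1) hj.2, fun N x hx M hM => hx.partSum_add hj.1 hM⟩
  | zero => exact ⟨1, one_pos, fun N x _ M _ => by simp⟩
  | add s t _ _ hs ht =>
    obtain ⟨C, hC, hCs⟩ := hs
    obtain ⟨D, hD, hDt⟩ := ht
    refine ⟨D * C, mul_pos hD hC, fun N x hx M hM => ?_⟩
    rw [mul_assoc, ← add_assoc]
    exact (mul_le_mul_of_nonneg_left (hCs N x hx M (by omega)) hD.le).trans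
      (hDt N x hx (M + s) (by omega))

lemma exists_forall_ge_mem_closure {S : Set ℕ} (hS : Nat.setGcd S = 1) :
    ∃ n₀, ∀ s, n₀ ≤ s → s ∈ AddSubmonoid.closure S := by
  obtain ⟨n₀, hn₀⟩ := Nat.exists_mem_closure_of_ge S
  exact ⟨n₀, fun s hs => hn₀ s hs (hS ▸ one_dvd s)⟩

lemma exists_const_mul_partSum_le {c : ℕ → ℝ} (hgcd : Nat.setGcd (posIndices c) = 1) (i : ℕ) :
    ∃ n₀ : ℕ, ∃ C : ℝ, 0 < C ∧ ∀ (N : ℕ) (x : ℕ → ℝ), Dominates c N x → ∀ d < i,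
      ∀ L, L + (n₀ + d) ≤ N → C * partSum x L ≤ partSum x (L + (n₀ + d)) := by
  obtain ⟨n₀, hn₀⟩ := exists_forall_ge_mem_closure hgcd
  choose! C hC hle using fun d (_ : d < i) =>
    exists_const_mul_partSum_le_of_mem_closure (hn₀ (n₀ + d) (Nat.le_add_right _ _))
  rcases Nat.eq_zero_or_pos i with rfl | hi
  · exact ⟨n₀, 1, one_pos, by simp⟩
  obtain ⟨d₀, hd₀, hmin⟩ := Finset.exists_min_image (Finset.range i) C ⟨0, Finset.mem_range.2 hi⟩
  refine ⟨n₀, C d₀, hC d₀ (Finset.mem_range.1 hd₀), fun N x hx d hd L hL => ?_⟩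
  exact (mul_le_mul_of_nonneg_right (hmin d (Finset.mem_range.2 hd))
    (partSum_nonneg hx.nonneg _)).trans (hle d hd N x hx L hL)

lemma pow_eq_exp_fillRate {c : ℕ → ℝ} {i : ℕ} (hi : i ∈ posIndices c) (q : ℕ) :
    (i * c i) ^ q = Real.exp (-(fillRate c i * (q * i : ℕ))) := by
  have hi0 : (0 : ℝ) < i := Nat.cast_pos.2 hi.1
  have : -(fillRate c i * (q * i : ℕ)) = q * Real.log (i * c i) := by
    rw [fillRate]
    push_cast
    field_simp
  rw [this, Real.exp_nat_mul, Real.exp_log (mul_pos hi0 hi.2)]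

lemma exists_const_mul_exp_fillRate_mul_partSum_le {c : ℕ → ℝ}
    (hgcd : Nat.setGcd (posIndices c) = 1) {i : ℕ} (hi : i ∈ posIndices c)
    (hrate : 0 ≤ fillRate c i) :
    ∃ n₀ : ℕ, ∃ C : ℝ, 0 < C ∧ ∀ (N : ℕ) (x : ℕ → ℝ), Dominates c N x → ∀ L M, L + n₀ ≤ M →
      M ≤ N → C * Real.exp (-(fillRate c i * (M - L))) * partSum x L ≤ partSum x M := by
  obtain ⟨n₀, C, hC, hfill⟩ := exists_const_mul_partSum_le hgcd i
  refine ⟨n₀, C, hC, fun N x hx L M hLM hMN => ?_⟩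
  obtain ⟨D, rfl⟩ := Nat.exists_eq_add_of_le hLM
  have hD : L + n₀ + D = L + (n₀ + D % i) + D / i * i := by
    have := Nat.mod_add_div' D i
    omega
  have hexp : Real.exp (-(fillRate c i * ((L + n₀ + D : ℕ) - L))) ≤ (i * c i) ^ (D / i) := by
    rw [pow_eq_exp_fillRate hi, Real.exp_le_exp, neg_le_neg_iff]
    refine mul_le_mul_of_nonneg_left ?_ hrate
    have : D / i * i + L ≤ L + n₀ + D := by omega
    rw [le_sub_iff_add_le]
    exact_mod_cast this
  have hx0 := partSum_nonneg hx.nonneg L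
  have hic : 0 ≤ i * c i := mul_nonneg i.cast_nonneg hi.2.le
  calc C * Real.exp (-(fillRate c i * ((L + n₀ + D : ℕ) - L))) * partSum x L
      ≤ C * (i * c i) ^ (D / i) * partSum x L := by gcongr
    _ = (i * c i) ^ (D / i) * (C * partSum x L) := by ring
    _ ≤ (i * c i) ^ (D / i) * partSum x (L + (n₀ + D % i)) :=
        mul_le_mul_of_nonneg_left (hfill N x hx _ (Nat.mod_lt _ hi.1) L (by omega))
          (pow_nonneg hic _)
    _ ≤ partSum x (L + n₀ + D) :=
        hD ▸ hx.pow_mul_partSum_le hi.1 hi.2.le _ (by omega)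

lemma factorial_mul_exp_le {n : ℕ} (hn : 1 ≤ n) :
    (n.factorial : ℝ) * Real.exp n ≤ Real.exp 1 * n ^ (n + 1) := by
  induction n, hn using Nat.le_induction with
  | base => simp
  | succ n hn ih =>
    have hpow : Real.exp 1 * (n : ℝ) ^ (n + 1) ≤ ((n : ℝ) + 1) ^ (n + 1) := by
      have h := Real.one_sub_div_pow_le_exp_neg (n := n + 1) (t := 1) (by simp)
      have hn1 : (1 : ℝ) - 1 / (n + 1 : ℕ) = n / (n + 1) := by push_cast; field_simp; ring
      rw [hn1, div_pow, Real.exp_neg, div_le_iff₀ (by positivity)] at h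
      rwa [← le_inv_mul_iff₀ (Real.exp_pos 1)]
    push_cast [Nat.factorial_succ]
    rw [Real.exp_add]
    calc ((n : ℝ) + 1) * n.factorial * (Real.exp n * Real.exp 1)
        = Real.exp 1 * (n + 1) * (n.factorial * Real.exp n) := by ring
      _ ≤ Real.exp 1 * (n + 1) * (Real.exp 1 * n ^ (n + 1)) := by gcongr
      _ ≤ Real.exp 1 * (n + 1) * (n + 1) ^ (n + 1) := by gcongr
      _ = Real.exp 1 * (n + 1) ^ (n + 1 + 1) := by ring

lemma mul_exp_le_pow_floor_div_factorial {s u : ℝ} (hs : 0 < s) (hs1 : s ≤ 1) (hu : 0 ≤ u) :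
    s * Real.exp ((1 - s) * u - 2) ≤ u ^ ⌊u⌋₊ / (⌊u⌋₊.factorial : ℝ) := by
  set n := ⌊u⌋₊
  have hnu : (n : ℝ) ≤ u := Nat.floor_le hu
  have hun : u < n + 1 := Nat.lt_floor_add_one u
  rcases Nat.eq_zero_or_pos n with h0 | hpos
  · have hexp : Real.exp ((1 - s) * u - 2) ≤ 1 := by
      rw [Real.exp_le_one_iff]
      rw [h0, Nat.cast_zero, zero_add] at hun
      nlinarith
    simpa [h0] using mul_le_one₀ hs1 (Real.exp_pos _).le hexp
  · rw [le_div_iff₀ (by positivity)]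
    have hu1 : 0 < u := lt_of_lt_of_le (Nat.cast_pos.2 hpos) hnu
    refine le_of_mul_le_mul_right ?_ (mul_pos hu1 (Real.exp_pos 1))
    calc s * Real.exp ((1 - s) * u - 2) * n.factorial * (u * Real.exp 1)
        = s * u * Real.exp ((1 - s) * u - 1) * n.factorial := by
          rw [show (1 - s) * u - 1 = ((1 - s) * u - 2) + 1 by ring, Real.exp_add]; ring
      _ ≤ Real.exp (s * u) * Real.exp ((1 - s) * u - 1) * n.factorial := by
          gcongr
          linarith [Real.add_one_le_exp (s * u)]
      _ = Real.exp (u - 1) * n.factorial := by rw [← Real.exp_add]; ring_nf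
      _ ≤ Real.exp n * n.factorial := by gcongr; linarith
      _ ≤ Real.exp 1 * n ^ (n + 1) := mul_comm (Real.exp n) _ ▸ factorial_mul_exp_le hpos
      _ ≤ Real.exp 1 * u ^ (n + 1) := by gcongr
      _ = u ^ n * (u * Real.exp 1) := by ring

lemma exists_const_mul_exp_le_partSum {a : ℕ → ℝ} (ha : ∀ j, 0 ≤ a j) {T : Finset ℕ}
    (hT : ∀ j ∈ T, 1 ≤ j) {s : ℝ} (hs : 0 < s) (hs1 : s ≤ 1) :
    ∃ C : ℝ, 0 < C ∧ ∀ (N : ℕ) (x : ℕ → ℝ), Dominates a N x →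
      C * Real.exp (N * ((1 - s) * ∑ j ∈ T, a j)) ≤ partSum x (∑ j ∈ T, ⌊N * a j⌋₊ * j) := by
  refine ⟨∏ _j ∈ T, s * Real.exp (-2), Finset.prod_pos fun _ _ => by positivity,
    fun N x hx => ?_⟩
  rw [mul_left_comm, Finset.mul_sum, Finset.mul_sum, Real.exp_sum, ← Finset.prod_mul_distrib]
  refine le_trans ?_ (prod_pow_div_factorial_le_partSum hx.nonneg hT fun j => ⌊N * a j⌋₊)
  refine Finset.prod_le_prod (fun j _ => by positivity) fun j _ => ?_
  have hu : 0 ≤ N * a j := mul_nonneg N.cast_nonneg (ha j)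
  calc s * Real.exp (-2) * Real.exp ((1 - s) * (N * a j))
      = s * Real.exp ((1 - s) * (N * a j) - 2) := by
        rw [mul_assoc, ← Real.exp_add, neg_add_eq_sub]
    _ ≤ (N * a j) ^ ⌊N * a j⌋₊ / (⌊N * a j⌋₊.factorial : ℝ) :=
        mul_exp_le_pow_floor_div_factorial hs hs1 hu
    _ ≤ x j ^ ⌊N * a j⌋₊ / (⌊N * a j⌋₊.factorial : ℝ) := by
        have := hx.le j
        gcongr

section FloorSum

variable {a : ℕ → ℝ} (T : Finset ℕ) (N : ℕ)

lemma sum_floor_mul_le (ha : ∀ j, 0 ≤ a j) :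
    ((∑ j ∈ T, ⌊N * a j⌋₊ * j : ℕ) : ℝ) ≤ N * ∑ j ∈ T, j * a j := by
  rw [Finset.mul_sum, Nat.cast_sum]
  refine Finset.sum_le_sum fun j _ => ?_
  rw [Nat.cast_mul, mul_left_comm, mul_comm]
  exact mul_le_mul_of_nonneg_left (Nat.floor_le (mul_nonneg N.cast_nonneg (ha j))) j.cast_nonneg

lemma sub_le_sum_floor_mul (a : ℕ → ℝ) :
    N * ∑ j ∈ T, j * a j - ∑ j ∈ T, (j : ℝ) ≤ ((∑ j ∈ T, ⌊N * a j⌋₊ * j : ℕ) : ℝ) := by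
  rw [Finset.mul_sum, Nat.cast_sum, ← Finset.sum_sub_distrib]
  refine Finset.sum_le_sum fun j _ => ?_
  have := mul_le_mul_of_nonneg_right (Nat.lt_floor_add_one (N * a j)).le (j.cast_nonneg (α := ℝ))
  push_cast
  linarith

end FloorSum

lemma eventually_exp_le_const_mul_exp {a b C : ℝ} (hab : a < b) (hC : 0 < C) :
    ∀ᶠ N : ℕ in atTop, Real.exp (N * a) ≤ C * Real.exp (N * b) := by
  have hlim := tendsto_natCast_atTop_atTop (R := ℝ).atTop_mul_const (sub_pos.2 hab)
  filter_upwards [hlim.eventually_ge_atTop (-Real.log C)] with N hN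
  rw [← Real.exp_log hC, ← Real.exp_add, Real.exp_le_exp]
  linarith

lemma exists_truncation {c : ℕ → ℝ} {g m l a : ℝ} (hc0 : c 0 = 0) (hg : HasSum c g)
    (hm : HasSum (fun j : ℕ => j * c j) m) (ha : a < g - l * (1 - m)) :
    ∃ T : Finset ℕ, (∀ j ∈ T, 1 ≤ j) ∧ ∃ δ : ℝ, 0 < δ ∧ δ < 1 ∧
      a < (1 - δ) * ((1 - δ) * ∑ j ∈ T, c j) - l * (1 - (1 - δ) * ∑ j ∈ T, j * c j) := by
  have hT : Tendsto (fun T : Finset ℕ => ∑ j ∈ T, c j - l * (1 - ∑ j ∈ T, j * c j)) atTop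
      (𝓝 (g - l * (1 - m))) :=
    Tendsto.sub hg ((Tendsto.const_sub 1 hm).const_mul l)
  obtain ⟨T, hT⟩ := (hT.eventually_const_lt ha).exists
  have hδ : Tendsto (fun δ : ℝ => (1 - δ) * ((1 - δ) * ∑ j ∈ T, c j) -
      l * (1 - (1 - δ) * ∑ j ∈ T, j * c j)) (𝓝[>] 0)
      (𝓝 ((1 - 0) * ((1 - 0) * ∑ j ∈ T, c j) - l * (1 - (1 - 0) * ∑ j ∈ T, j * c j))) :=
    (Continuous.tendsto (by fun_prop) 0).mono_left nhdsWithin_le_nhds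
  simp only [sub_zero, one_mul] at hδ
  obtain ⟨δ, hlt, hδ0, hδ1⟩ :=
    ((hδ.eventually_const_lt hT).and (Ioo_mem_nhdsGT zero_lt_one)).exists
  refine ⟨T.erase 0, fun j hj => Nat.one_le_iff_ne_zero.2 (Finset.ne_of_mem_erase hj), δ, hδ0, hδ1,
    ?_⟩
  rwa [Finset.sum_erase _ hc0, Finset.sum_erase _ (by simp)]

lemma exists_size_const_mul_exp_le_partSum {c : ℕ → ℝ} (hc : ∀ j, 0 ≤ c j) {T : Finset ℕ}
    (hT : ∀ j ∈ T, 1 ≤ j) {δ : ℝ} (hδ : 0 < δ) (hδ1 : δ < 1) :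
    ∃ C : ℝ, 0 < C ∧ ∀ (N : ℕ) (x : ℕ → ℝ), Dominates c N x → ∃ L : ℕ,
      L ≤ N * ((1 - δ) * ∑ j ∈ T, j * c j) ∧
      N * ((1 - δ) * ∑ j ∈ T, j * c j) - ∑ j ∈ T, (j : ℝ) ≤ L ∧
      C * Real.exp (N * ((1 - δ) * ((1 - δ) * ∑ j ∈ T, c j))) ≤ partSum x L := by
  have hδc (j : ℕ) : 0 ≤ (1 - δ) * c j := mul_nonneg (by linarith) (hc j)
  have hmass : (1 - δ) * ∑ j ∈ T, j * c j = ∑ j ∈ T, j * ((1 - δ) * c j) := by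
    rw [Finset.mul_sum]
    exact Finset.sum_congr rfl fun j _ => by ring
  obtain ⟨C, hC, hle⟩ := exists_const_mul_exp_le_partSum hδc hT hδ hδ1.le
  simp_rw [hmass, Finset.mul_sum _ _ (1 - δ)]
  refine ⟨C, hC, fun N x hx => ⟨_, sum_floor_mul_le T N hδc, sub_le_sum_floor_mul T N _, ?_⟩⟩
  simpa only [Finset.mul_sum] using hle N x (hx.smul hc (by linarith))

/-- Typical multiplicities `⌊(1 - δ) N c_j⌋` produce a partition of size about `m N` and of weight
about `exp (g N)`; the missing `(1 - m) N` is filled at the rate of the part `i`. -/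
lemma eventually_exp_le_partSum_sub_of_lt_sub_fillRate {c : ℕ → ℝ} (hc : ∀ j, 0 ≤ c j)
    (hc0 : c 0 = 0) {g m : ℝ} (hg : HasSum c g) (hm : HasSum (fun j : ℕ => j * c j) m) (hm1 : m ≤ 1)
    (hgcd : Nat.setGcd (posIndices c) = 1) {i : ℕ} (hi : i ∈ posIndices c) {a : ℝ}
    (ha : a < g - fillRate c i * (1 - m)) (k : ℕ) :
    ∀ᶠ N : ℕ in atTop, ∀ x : ℕ → ℝ, Dominates c N x → Real.exp (N * a) ≤ partSum x (N - k) := by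
  have hterm (j : ℕ) : 0 ≤ j * c j := mul_nonneg j.cast_nonneg (hc j)
  have hrate : 0 ≤ fillRate c i := div_nonneg (neg_nonneg.2 (Real.log_nonpos (hterm i)
    ((le_hasSum hm i fun j _ => hterm j).trans hm1))) i.cast_nonneg
  obtain ⟨T, hT, δ, hδ, hδ1, hlt⟩ := exists_truncation hc0 hg hm ha
  obtain ⟨C, hC, htypical⟩ := exists_size_const_mul_exp_le_partSum hc hT hδ hδ1
  obtain ⟨n₀, D, hD, hfill⟩ := exists_const_mul_exp_fillRate_mul_partSum_le hgcd hi hrate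
  set mT := ∑ j ∈ T, j * c j
  have hmT : mT ≤ 1 := (sum_le_hasSum T (fun j _ => hterm j) hm).trans hm1
  have hroom := ((tendsto_natCast_atTop_atTop (R := ℝ)).const_mul_atTop hδ).eventually_ge_atTop
    ((n₀ + k : ℕ) : ℝ)
  have hconst : 0 < D * C * Real.exp (-(fillRate c i * ∑ j ∈ T, (j : ℝ))) := by positivity
  filter_upwards [hroom, eventually_exp_le_const_mul_exp hlt hconst] with N hroom hN x hx
  obtain ⟨L, hLle, hLge, hL⟩ := htypical N x hx
  have hLN : L + n₀ + k ≤ N := by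
    have : N * ((1 - δ) * mT) ≤ N * ((1 - δ) * 1) := by gcongr
    push_cast at hroom
    exact_mod_cast (by linarith : (L : ℝ) + n₀ + k ≤ N)
  have hNk : ((N - k : ℕ) : ℝ) ≤ N := mod_cast Nat.sub_le N k
  have hfilled := mul_le_mul_of_nonneg_left
    (by linarith : ((N - k : ℕ) : ℝ) - L ≤ N - (N * ((1 - δ) * mT) - ∑ j ∈ T, (j : ℝ))) hrate
  refine hN.trans (le_trans ?_ (hfill N x hx L (N - k) (by omega) (Nat.sub_le N k)))
  refine le_trans ?_ (mul_le_mul_of_nonneg_left hL (by positivity))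
  rw [mul_mul_mul_comm D, mul_assoc (D * C), ← Real.exp_add, ← Real.exp_add]
  refine mul_le_mul_of_nonneg_left (Real.exp_le_exp.2 ?_) (by positivity)
  linarith

lemma eventually_exp_le_partSum_sub {c : ℕ → ℝ} (hc : ∀ j, 0 ≤ c j) (hc0 : c 0 = 0) {g m : ℝ}
    (hg : HasSum c g) (hm : HasSum (fun j : ℕ => j * c j) m) (hm1 : m ≤ 1)
    (hgcd : Nat.setGcd (posIndices c) = 1)
    (hfill : ∀ ε : ℝ, 0 < ε → ∃ i ∈ posIndices c, fillRate c i * (1 - m) < ε) {a : ℝ} (ha : a < g)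
    (k : ℕ) :
    ∀ᶠ N : ℕ in atTop, ∀ x : ℕ → ℝ, Dominates c N x → Real.exp (N * a) ≤ partSum x (N - k) := by
  obtain ⟨i, hi, hlt⟩ := hfill (g - a) (sub_pos.2 ha)
  exact eventually_exp_le_partSum_sub_of_lt_sub_fillRate hc hc0 hg hm hm1 hgcd hi
    (by linarith) k

/-! ### Ratios of partition functions -/

/-- The coefficients `a_j r^j / j` of `g_a` at the point `r`. For `a = κ` and `r = r_*` they are the
limits of `C_j / N`. -/
noncomputable def limitDensity (a : ℕ → ℝ) (r : ℝ) (j : ℕ) : ℝ := a j * r ^ j / j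

lemma limitDensity_nonneg {a : ℕ → ℝ} (ha : ∀ j, 1 ≤ j → 0 ≤ a j) {r : ℝ} (hr : 0 ≤ r) (j : ℕ) :
    0 ≤ limitDensity a r j := by
  rcases Nat.eq_zero_or_pos j with rfl | hj
  · simp [limitDensity]
  · exact div_nonneg (mul_nonneg (ha j hj) (pow_nonneg hr j)) j.cast_nonneg

lemma limitDensity_le_limitDensity {a : ℕ → ℝ} (ha : ∀ j, 1 ≤ j → 0 ≤ a j) {ρ r : ℝ} (hρ : 0 ≤ ρ)
    (hρr : ρ ≤ r) (j : ℕ) : limitDensity a ρ j ≤ limitDensity a r j := by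
  rcases Nat.eq_zero_or_pos j with rfl | hj
  · simp [limitDensity]
  · have := ha j hj
    unfold limitDensity
    gcongr

lemma natCast_mul_limitDensity (a : ℕ → ℝ) (r : ℝ) {j : ℕ} (hj : 1 ≤ j) :
    j * limitDensity a r j = a j * r ^ j :=
  mul_div_cancel₀ _ (Nat.cast_ne_zero.2 (Nat.one_le_iff_ne_zero.1 hj))

lemma posIndices_limitDensity (a : ℕ → ℝ) {r : ℝ} (hr : 0 < r) :
    posIndices (limitDensity a r) = posIndices a := by
  ext j
  refine and_congr_right fun hj => ?_
  rw [limitDensity, div_pos_iff_of_pos_right (Nat.cast_pos.2 hj),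
    mul_pos_iff_of_pos_right (pow_pos hr j)]

lemma cycleParam_mul_pow (θ κ : ℕ → ℝ) (N j : ℕ) (r : ℝ) :
    cycleParam θ κ N j * r ^ j = limitDensity θ r j + N * limitDensity κ r j := by
  rw [cycleParam, limitDensity, limitDensity]
  ring

lemma cycleParam_nonneg {θ κ : ℕ → ℝ} (hθ : ∀ j, 1 ≤ j → 0 ≤ θ j) (hκ : ∀ j, 1 ≤ j → 0 ≤ κ j)
    (N j : ℕ) : 0 ≤ cycleParam θ κ N j := by
  rcases Nat.eq_zero_or_pos j with rfl | hj
  · simp [cycleParam]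
  · exact div_nonneg (add_nonneg (hθ j hj) (mul_nonneg N.cast_nonneg (hκ j hj))) j.cast_nonneg

lemma tendsto_cycleParam_div (θ κ : ℕ → ℝ) (j : ℕ) :
    Tendsto (fun N : ℕ => cycleParam θ κ N j / N) atTop (𝓝 (κ j / j)) := by
  have hlim : Tendsto (fun N : ℕ => θ j / j / N + κ j / j) atTop (𝓝 (0 + κ j / j)) :=
    (tendsto_const_div_atTop_nhds_zero_nat _).add_const _
  rw [zero_add] at hlim
  refine hlim.congr' ?_
  filter_upwards [eventually_ne_atTop 0] with N hN
  rw [cycleParam]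
  field_simp

section Tilting

variable {x : ℕ → ℝ} (hx : ∀ j, 0 ≤ x j)
include hx

lemma partSum_update_le_exp {i M : ℕ} (hi : i ∈ Finset.Icc 1 M) {a : ℝ} (ha : 0 ≤ a) :
    partSum (Function.update x i (x i * a)) M ≤
      Real.exp (∑ j ∈ Finset.Icc 1 M, x j + (a - 1) * x i) := by
  have hup (j : ℕ) : 0 ≤ Function.update x i (x i * a) j := by
    rw [Function.update_apply]
    split_ifs
    exacts [mul_nonneg (hx i) ha, hx j]
  refine (partSum_le_exp hup M).trans_eq ?_
  rw [Finset.sum_update_of_mem hi, ← Finset.add_sum_erase _ _ hi, Finset.sdiff_singleton_eq_erase]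
  congr 1
  ring

lemma exp_mul_partSum_le_partSum_update {i : ℕ} (hi : 1 ≤ i) {M : ℕ} (hpos : 0 < partSum x (M + i))
    (t : ℝ) :
    Real.exp (t * (x i * (partSum x M / partSum x (M + i)))) * partSum x (M + i) ≤
      partSum (Function.update x i (x i * Real.exp t)) (M + i) := by
  have jensen := convexOn_exp.map_centerMass_le (t := Finset.univ)
    (w := fun p : (M + i).Partition => partWeight x p.parts) (p := fun p => t * p.parts.count i)
    (fun p _ => partWeight_nonneg hx p.parts) hpos (fun _ _ => Set.mem_univ _)
  have hmean : ∑ p : (M + i).Partition, partWeight x p.parts * (t * p.parts.count i) =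
      t * (x i * partSum x M) := by
    simp_rw [← sum_partWeight_mul_count x hi, Finset.mul_sum, mul_left_comm]
  have htilt : ∑ p : (M + i).Partition, partWeight x p.parts * Real.exp (t * p.parts.count i) =
      partSum (Function.update x i (x i * Real.exp t)) (M + i) := by
    simp_rw [← sum_partWeight_mul_pow_count, ← Real.exp_nat_mul, mul_comm t]
  simp only [Finset.centerMass, smul_eq_mul, Function.comp_apply, hmean, htilt] at jensen
  rw [← partSum, ← div_eq_inv_mul, ← div_eq_inv_mul, le_div_iff₀ hpos] at jensen
  rwa [← mul_div_assoc, ← mul_div_assoc]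

lemma mul_mean_add_log_partSum_le {i : ℕ} (hi : 1 ≤ i) {M : ℕ} (hpos : 0 < partSum x (M + i))
    (t : ℝ) :
    t * (x i * (partSum x M / partSum x (M + i))) + Real.log (partSum x (M + i)) ≤
      ∑ j ∈ Finset.Icc 1 (M + i), x j + (Real.exp t - 1) * x i := by
  rw [← Real.exp_le_exp, Real.exp_add, Real.exp_log hpos]
  exact (exp_mul_partSum_le_partSum_update hx hi hpos t).trans
    (partSum_update_le_exp hx (Finset.mem_Icc.2 ⟨hi, Nat.le_add_left i M⟩) (Real.exp_pos t).le)

end Tilting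

lemma tendsto_of_eventually_mul_lt {y : ℕ → ℝ} {q : ℝ}
    (h : ∀ t b : ℝ, (Real.exp t - 1) * q < b → ∀ᶠ N in atTop, t * y N < b) :
    Tendsto y atTop (𝓝 q) := by
  have hderiv : HasDerivAt (fun t => Real.exp t * q) q 0 := by
    simpa using (Real.hasDerivAt_exp 0).mul_const q
  refine tendsto_order.2 ⟨fun a ha => ?_, fun b hb => ?_⟩
  · obtain ⟨t, hlt, ht⟩ := ((hderiv.tendsto_slope_zero_left.eventually_const_lt ha).and
      self_mem_nhdsWithin).exists
    have ht : t < 0 := ht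
    rw [zero_add, Real.exp_zero, smul_eq_mul, inv_mul_eq_div, lt_div_iff_of_neg ht, ← sub_mul,
      mul_comm a] at hlt
    filter_upwards [h t (t * a) hlt] with N hN
    exact (mul_lt_mul_left_of_neg ht).1 hN
  · obtain ⟨t, hlt, ht⟩ := ((hderiv.tendsto_slope_zero_right.eventually_lt_const hb).and
      self_mem_nhdsWithin).exists
    have ht : 0 < t := ht
    rw [zero_add, Real.exp_zero, smul_eq_mul, inv_mul_lt_iff₀ ht, ← sub_mul] at hlt
    filter_upwards [h t (t * b) hlt] with N hN
    exact lt_of_mul_lt_mul_left hN ht.le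

/-- The properties of `r = r_*` on which the asymptotics of the partition functions rest: the
densities `limitDensity κ r` describe partitions of size at most `1`, the missing size can be filled
at negligible exponential cost, and `g_θ` converges inside the disk of radius `r`. -/
structure SaddlePoint (θ κ : ℕ → ℝ) (r : ℝ) : Prop where
  θ_nonneg : ∀ j, 1 ≤ j → 0 ≤ θ j
  κ_nonneg : ∀ j, 1 ≤ j → 0 ≤ κ j
  pos : 0 < r
  summable_mass : Summable fun j : ℕ => j * limitDensity κ r j
  mass_le_one : ∑' j : ℕ, j * limitDensity κ r j ≤ 1
  fill : ∀ ε : ℝ, 0 < ε → ∃ i ∈ posIndices κ,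
    fillRate (limitDensity κ r) i * (1 - ∑' j : ℕ, j * limitDensity κ r j) < ε
  setGcd_eq_one : Nat.setGcd (posIndices κ) = 1
  summable_θ : ∀ ρ : ℝ, 0 < ρ → ρ < r → Summable (limitDensity θ ρ)

namespace SaddlePoint

variable {θ κ : ℕ → ℝ} {r : ℝ}

lemma summable_limitDensity (h : SaddlePoint θ κ r) : Summable (limitDensity κ r) := by
  have hnonneg := limitDensity_nonneg h.κ_nonneg h.pos.le
  refine h.summable_mass.of_nonneg_of_le hnonneg fun j => ?_
  rcases Nat.eq_zero_or_pos j with rfl | hj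
  · simp [limitDensity]
  · exact le_mul_of_one_le_left (hnonneg j) (Nat.one_le_cast.2 hj)

lemma eventually_exp_le (h : SaddlePoint θ κ r) {a : ℝ} (ha : a < ∑' j, limitDensity κ r j)
    (k : ℕ) :
    ∀ᶠ N : ℕ in atTop,
      Real.exp (N * a) ≤ partSum (cycleParam θ κ N) (N - k) * r ^ (N - k) := by
  filter_upwards [eventually_exp_le_partSum_sub (limitDensity_nonneg h.κ_nonneg h.pos.le)
    (by simp [limitDensity]) h.summable_limitDensity.hasSum h.summable_mass.hasSum h.mass_le_one
    (posIndices_limitDensity κ h.pos ▸ h.setGcd_eq_one)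
    (posIndices_limitDensity κ h.pos ▸ h.fill) ha k] with N hN
  rw [← partSum_mul_pow]
  refine hN _ ⟨fun j => ?_, fun j => ?_⟩
  · exact mul_nonneg (cycleParam_nonneg h.θ_nonneg h.κ_nonneg N j) (pow_nonneg h.pos.le j)
  · rw [Pi.mul_apply, cycleParam_mul_pow]
    exact le_add_of_nonneg_left (limitDensity_nonneg h.θ_nonneg h.pos.le j)

lemma eventually_partSum_pos (h : SaddlePoint θ κ r) (k : ℕ) :
    ∀ᶠ N : ℕ in atTop, 0 < partSum (cycleParam θ κ N) (N - k) := by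
  filter_upwards [h.eventually_exp_le (sub_one_lt _) k] with N hN
  exact pos_of_mul_pos_left ((Real.exp_pos _).trans_le hN) (pow_nonneg h.pos.le _)

section Mean

variable (h : SaddlePoint θ κ r) {ρ : ℝ} (hρ : 0 < ρ) (hρr : ρ < r)
include h hρ hρr

lemma sum_cycleParam_mul_pow_le (N M : ℕ) :
    ∑ j ∈ Finset.Icc 1 M, cycleParam θ κ N j * ρ ^ j ≤
      ∑' j, limitDensity θ ρ j + N * ∑' j, limitDensity κ r j := by
  simp_rw [cycleParam_mul_pow, Finset.sum_add_distrib, ← Finset.mul_sum]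
  refine add_le_add ((h.summable_θ ρ hρ hρr).sum_le_tsum _ fun j _ =>
    limitDensity_nonneg h.θ_nonneg hρ.le j) (mul_le_mul_of_nonneg_left ?_ N.cast_nonneg)
  exact (Finset.sum_le_sum fun j _ =>
      limitDensity_le_limitDensity h.κ_nonneg hρ.le hρr.le j).trans
    (h.summable_limitDensity.sum_le_tsum _ fun j _ => limitDensity_nonneg h.κ_nonneg h.pos.le j)

lemma mul_mean_le {i : ℕ} (hi : 1 ≤ i) {N k : ℕ} (hN : k + i ≤ N) {a : ℝ}
    (ha : Real.exp (N * a) ≤ partSum (cycleParam θ κ N) (N - k) * r ^ (N - k)) (t : ℝ) :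
    t * (cycleParam θ κ N i * (partSum (cycleParam θ κ N) (N - k - i) /
        partSum (cycleParam θ κ N) (N - k))) ≤
      N * (Real.log r - Real.log ρ + (∑' j, limitDensity κ r j - a)) +
        ∑' j, limitDensity θ ρ j + (Real.exp t - 1) * (cycleParam θ κ N i * ρ ^ i) := by
  obtain ⟨M, rfl⟩ := Nat.exists_eq_add_of_le' hN
  simp only [show M + (k + i) - k = M + i by omega, Nat.add_sub_cancel] at ha ⊢
  set N := M + (k + i)
  set x := cycleParam θ κ N
  have hZ : 0 < partSum x (M + i) :=
    pos_of_mul_pos_left ((Real.exp_pos _).trans_le ha) (pow_nonneg h.pos.le _)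
  have hmean := mul_mean_add_log_partSum_le (x := x * fun j => ρ ^ j)
    (fun j => mul_nonneg (cycleParam_nonneg h.θ_nonneg h.κ_nonneg N j) (pow_nonneg hρ.le j)) hi
    (M := M) (by rw [partSum_mul_pow]; positivity) t
  rw [partSum_mul_pow, partSum_mul_pow, Real.log_mul hZ.ne' (by positivity), Real.log_pow] at hmean
  have hratio : x i * ρ ^ i * (partSum x M * ρ ^ M / (partSum x (M + i) * ρ ^ (M + i))) =
      x i * (partSum x M / partSum x (M + i)) := by
    rw [pow_add]
    field_simp
  rw [Pi.mul_apply, hratio] at hmean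
  have hlower := Real.log_le_log (Real.exp_pos _) ha
  rw [Real.log_exp, Real.log_mul hZ.ne' (pow_pos h.pos _).ne', Real.log_pow] at hlower
  have hupper := h.sum_cycleParam_mul_pow_le hρ hρr N (M + i)
  have hlog : ((M + i : ℕ) : ℝ) * (Real.log r - Real.log ρ) ≤ N * (Real.log r - Real.log ρ) :=
    mul_le_mul_of_nonneg_right (Nat.cast_le.2 (by omega))
      (sub_nonneg.2 (Real.log_le_log hρ hρr.le))
  simp only [Pi.mul_apply] at hmean
  linarith

lemma eventually_mul_mean_lt {i : ℕ} (hi : 1 ≤ i) (k : ℕ) {t b : ℝ}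
    (hb : Real.log r - Real.log ρ + (Real.exp t - 1) * limitDensity κ ρ i < b) :
    ∀ᶠ N : ℕ in atTop, t * (cycleParam θ κ N i / N * (partSum (cycleParam θ κ N) (N - k - i) /
        partSum (cycleParam θ κ N) (N - k))) < b := by
  obtain ⟨c, hc, hcb⟩ := exists_between hb
  set ε := b - c with hε
  have hlim : Tendsto (fun N : ℕ => Real.log r - Real.log ρ + ε + (∑' j, limitDensity θ ρ j) / N +
      (Real.exp t - 1) * (cycleParam θ κ N i / N * ρ ^ i)) atTop
      (𝓝 (Real.log r - Real.log ρ + ε + 0 + (Real.exp t - 1) * (κ i / i * ρ ^ i))) :=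
    ((tendsto_const_div_atTop_nhds_zero_nat _).const_add _).add
      (((tendsto_cycleParam_div θ κ i).mul_const _).const_mul _)
  have hlt : Real.log r - Real.log ρ + ε + 0 + (Real.exp t - 1) * (κ i / i * ρ ^ i) < b := by
    rw [limitDensity, mul_div_right_comm] at hc
    linarith
  have hg : ∑' j, limitDensity κ r j - ε < ∑' j, limitDensity κ r j := by linarith
  filter_upwards [hlim.eventually_lt_const hlt, h.eventually_exp_le hg k,
    eventually_ge_atTop (k + i), eventually_gt_atTop 0] with N hN hexp hki hN0
  have hN0 : (0 : ℝ) < N := Nat.cast_pos.2 hN0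
  refine lt_of_le_of_lt (le_of_mul_le_mul_left ?_ hN0) hN
  have hmean := h.mul_mean_le hρ hρr hi hki hexp t
  rw [sub_sub_cancel] at hmean
  calc _ = _ := by field_simp
    _ ≤ _ := hmean
    _ = _ := by field_simp

end Mean

lemma tendsto_mean (h : SaddlePoint θ κ r) {i : ℕ} (hi : 1 ≤ i) (k : ℕ) :
    Tendsto (fun N : ℕ => cycleParam θ κ N i / N * (partSum (cycleParam θ κ N) (N - k - i) /
        partSum (cycleParam θ κ N) (N - k))) atTop (𝓝 (limitDensity κ r i)) := by
  refine tendsto_of_eventually_mul_lt fun t b hb => ?_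
  have hlim : Tendsto (fun ρ : ℝ => Real.log r - Real.log ρ + (Real.exp t - 1) * limitDensity κ ρ i)
      (𝓝[<] r) (𝓝 (Real.log r - Real.log r + (Real.exp t - 1) * limitDensity κ r i)) := by
    refine Tendsto.mono_left ?_ nhdsWithin_le_nhds
    refine ((Real.continuousAt_log h.pos.ne').tendsto.const_sub _).add (Tendsto.const_mul _ ?_)
    exact Continuous.tendsto (by unfold limitDensity; fun_prop) r
  rw [sub_self, zero_add] at hlim
  obtain ⟨ρ, hlt, hρ, hρr⟩ := ((hlim.eventually_lt_const hb).and (Ioo_mem_nhdsLT h.pos)).exists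
  exact h.eventually_mul_mean_lt hρ hρr hi k hlt

lemma tendsto_partSum_ratio_of_mem_posIndices (h : SaddlePoint θ κ r) {j : ℕ}
    (hj : j ∈ posIndices κ) (k : ℕ) :
    Tendsto (fun N : ℕ => partSum (cycleParam θ κ N) (N - k - j) /
      partSum (cycleParam θ κ N) (N - k)) atTop (𝓝 (r ^ j)) := by
  have hpos : 0 < κ j / j := div_pos hj.2 (Nat.cast_pos.2 hj.1)
  have hlim := (h.tendsto_mean hj.1 k).div (tendsto_cycleParam_div θ κ j) hpos.ne'
  rw [limitDensity, mul_div_right_comm, mul_div_cancel_left₀ _ hpos.ne'] at hlim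
  refine hlim.congr' ?_
  filter_upwards [(tendsto_cycleParam_div θ κ j).eventually_const_lt hpos] with N hN
  exact mul_div_cancel_left₀ _ hN.ne'

lemma tendsto_partSum_ratio_of_mem_closure (h : SaddlePoint θ κ r) {s : ℕ}
    (hs : s ∈ AddSubmonoid.closure (posIndices κ)) (k : ℕ) :
    Tendsto (fun N : ℕ => partSum (cycleParam θ κ N) (N - k - s) /
      partSum (cycleParam θ κ N) (N - k)) atTop (𝓝 (r ^ s)) := by
  induction hs using AddSubmonoid.closure_induction generalizing k with
  | mem j hj => exact h.tendsto_partSum_ratio_of_mem_posIndices hj k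
  | zero =>
    rw [pow_zero]
    refine tendsto_const_nhds.congr' ?_
    filter_upwards [h.eventually_partSum_pos k] with N hN
    rw [Nat.sub_zero, div_self hN.ne']
  | add s t _ _ hs ht =>
    rw [pow_add, mul_comm]
    refine ((ht (k + s)).mul (hs k)).congr' ?_
    filter_upwards [h.eventually_partSum_pos (k + s)] with N hN
    rw [Nat.sub_sub N k s, Nat.sub_sub N k (s + t), Nat.sub_sub N (k + s) t, add_assoc,
      div_mul_div_cancel₀ hN.ne']

theorem tendsto_partSum_ratio (h : SaddlePoint θ κ r) (i : ℕ) :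
    Tendsto (fun N : ℕ => partSum (cycleParam θ κ N) (N - i) / partSum (cycleParam θ κ N) N) atTop
      (𝓝 (r ^ i)) := by
  -- Both `n₀` and `i + n₀` are sums of elements of `posIndices κ`, and `r^i = r^(i + n₀) / r^n₀`.
  obtain ⟨n₀, hn₀⟩ := exists_forall_ge_mem_closure h.setGcd_eq_one
  have hnum := h.tendsto_partSum_ratio_of_mem_closure (hn₀ (i + n₀) (Nat.le_add_left _ _)) 0
  have hden := h.tendsto_partSum_ratio_of_mem_closure (hn₀ n₀ le_rfl) i
  have hpow := (pow_pos h.pos n₀).ne'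
  have hlim := hnum.div hden hpow
  rw [pow_add, mul_div_cancel_right₀ _ hpow] at hlim
  refine hlim.congr' ?_
  filter_upwards [h.eventually_partSum_pos i, h.eventually_partSum_pos (i + n₀)] with N hi hin₀
  simp only [Pi.div_apply, Nat.sub_sub, Nat.sub_zero]
  field_simp

end SaddlePoint

/-! ### Expectations -/

section Expect

variable {θ κ : ℕ → ℝ} {N : ℕ}

lemma expect_add (X Y : Equiv.Perm (Fin N) → ℝ) :
    expect θ κ N (fun σ => X σ + Y σ) = expect θ κ N X + expect θ κ N Y := by
  simp_rw [expect, mul_add, Finset.sum_add_distrib]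

lemma expect_sub (X Y : Equiv.Perm (Fin N) → ℝ) :
    expect θ κ N (fun σ => X σ - Y σ) = expect θ κ N X - expect θ κ N Y := by
  simp_rw [expect, mul_sub, Finset.sum_sub_distrib]

lemma expect_const_mul (c : ℝ) (X : Equiv.Perm (Fin N) → ℝ) :
    expect θ κ N (fun σ => c * X σ) = c * expect θ κ N X := by
  simp_rw [expect, Finset.mul_sum, mul_left_comm]

lemma expect_sum {ι : Type*} (s : Finset ι) (X : ι → Equiv.Perm (Fin N) → ℝ) :
    expect θ κ N (fun σ => ∑ i ∈ s, X i σ) = ∑ i ∈ s, expect θ κ N (X i) := by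
  simp_rw [expect, Finset.mul_sum]
  exact Finset.sum_comm

lemma expect_const (c : ℝ) :
    expect θ κ N (fun _ => c) =
      c * (partSum (cycleParam θ κ N) N / partSum (cycleParam θ κ N) N) := by
  rw [expect_eq_sum_div_partSum θ κ N fun _ => c, ← Finset.sum_mul, ← partSum]
  ring

lemma expect_const_le {c : ℝ} (hc : 0 ≤ c) : expect θ κ N (fun _ => c) ≤ c := by
  rw [expect_const]
  exact mul_le_of_le_one_right hc (div_self_le_one _)

variable (hθ : ∀ j, 1 ≤ j → 0 ≤ θ j) (hκ : ∀ j, 1 ≤ j → 0 ≤ κ j)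
include hθ hκ

lemma permProb_nonneg (σ : Equiv.Perm (Fin N)) : 0 ≤ permProb θ κ N σ := by
  have weight_nonneg (τ : Equiv.Perm (Fin N)) : 0 ≤ cycleWeight θ κ N τ :=
    Finset.prod_nonneg fun j hj => pow_nonneg (add_nonneg (hθ j (Finset.mem_Icc.1 hj).1)
      (mul_nonneg N.cast_nonneg (hκ j (Finset.mem_Icc.1 hj).1))) _
  exact div_nonneg (weight_nonneg σ) (mul_nonneg (Nat.cast_nonneg _) (mul_nonneg (by positivity)
    (Finset.sum_nonneg fun τ _ => weight_nonneg τ)))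

lemma expect_mono {X Y : Equiv.Perm (Fin N) → ℝ} (h : ∀ σ, X σ ≤ Y σ) :
    expect θ κ N X ≤ expect θ κ N Y :=
  Finset.sum_le_sum fun σ _ => mul_le_mul_of_nonneg_left (h σ) (permProb_nonneg hθ hκ σ)

lemma expect_nonneg {X : Equiv.Perm (Fin N) → ℝ} (h : ∀ σ, 0 ≤ X σ) : 0 ≤ expect θ κ N X :=
  Finset.sum_nonneg fun σ _ => mul_nonneg (permProb_nonneg hθ hκ σ) (h σ)

lemma abs_expect_sub_le {X Y Z : Equiv.Perm (Fin N) → ℝ} (h : ∀ σ, |X σ - Y σ| ≤ Z σ) :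
    |expect θ κ N X - expect θ κ N Y| ≤ expect θ κ N Z := by
  rw [← expect_sub, expect]
  refine (Finset.abs_sum_le_sum_abs _ _).trans (Finset.sum_le_sum fun σ _ => ?_)
  rw [abs_mul, abs_of_nonneg (permProb_nonneg hθ hκ σ)]
  exact mul_le_mul_of_nonneg_left (h σ) (permProb_nonneg hθ hκ σ)

end Expect

/-- Convergence to a constant in mean. Unlike convergence in probability it passes to products of
uniformly bounded variables by the triangle inequality alone. -/
def TendstoInMean (θ κ : ℕ → ℝ) (X : (N : ℕ) → Equiv.Perm (Fin N) → ℝ) (c : ℝ) : Prop :=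
  Tendsto (fun N => expect θ κ N fun σ => |X N σ - c|) atTop (𝓝 0)

section TendstoInMean

variable {θ κ : ℕ → ℝ} (hθ : ∀ j, 1 ≤ j → 0 ≤ θ j) (hκ : ∀ j, 1 ≤ j → 0 ≤ κ j)
include hθ hκ

lemma sq_mul_prob_le {N : ℕ} (X : Equiv.Perm (Fin N) → ℝ) {ε : ℝ} (hε : 0 ≤ ε) :
    ε ^ 2 * prob θ κ N {σ | ε ≤ |X σ|} ≤ expect θ κ N fun σ => X σ ^ 2 := by
  rw [prob, ← expect_const_mul]
  refine expect_mono hθ hκ fun σ => ?_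
  by_cases hσ : ε ≤ |X σ|
  · rw [Set.indicator_of_mem (by exact hσ), mul_one, ← sq_abs (X σ)]
    exact pow_le_pow_left₀ hε hσ 2
  · rw [Set.indicator_of_notMem (by exact hσ), mul_zero]
    exact sq_nonneg _

lemma tendstoInProb_of_tendsto_expect_sq {X : (N : ℕ) → Equiv.Perm (Fin N) → ℝ} {c : ℝ}
    (hX : Tendsto (fun N => expect θ κ N fun σ => (X N σ - c) ^ 2) atTop (𝓝 0)) :
    TendstoInProb θ κ X c := by
  intro ε hε
  have hlim := hX.const_mul (ε ^ 2)⁻¹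
  rw [mul_zero] at hlim
  refine squeeze_zero (fun N => expect_nonneg hθ hκ fun σ =>
    Set.indicator_nonneg (fun _ _ => zero_le_one) σ) (fun N => ?_) hlim
  rw [← div_eq_inv_mul, le_div_iff₀' (by positivity)]
  exact sq_mul_prob_le hθ hκ _ hε.le

lemma tendstoInMean_comp {X : (N : ℕ) → Equiv.Perm (Fin N) → ℝ} {c : ℝ}
    (hX : TendstoInProb θ κ X c) (f : ℝ →ᵇ ℝ) :
    TendstoInMean θ κ (fun N σ => f (X N σ)) (f c) := by
  refine tendsto_order.2 ⟨fun a ha => Eventually.of_forall fun N =>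
    ha.trans_le (expect_nonneg hθ hκ fun σ => abs_nonneg _), fun ε hε => ?_⟩
  obtain ⟨δ, hδ, hf⟩ := Metric.continuousAt_iff.1 (f.continuous.continuousAt (x := c))
    (ε / 2) (half_pos hε)
  have hlim := ((hX δ hδ).const_mul (2 * ‖f‖)).const_add (ε / 2)
  rw [mul_zero, add_zero] at hlim
  filter_upwards [hlim.eventually_lt_const (half_lt_self hε)] with N hN
  refine lt_of_le_of_lt ?_ hN
  calc expect θ κ N (fun σ => |f (X N σ) - f c|)
      ≤ expect θ κ N fun σ =>
          ε / 2 + 2 * ‖f‖ * Set.indicator {σ | δ ≤ |X N σ - c|} (fun _ => 1) σ := by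
        refine expect_mono hθ hκ fun σ => ?_
        rw [← Real.dist_eq]
        by_cases hσ : δ ≤ |X N σ - c|
        · rw [Set.indicator_of_mem (by exact hσ), mul_one]
          exact (f.dist_le_two_norm (X N σ) c).trans (le_add_of_nonneg_left (half_pos hε).le)
        · rw [Set.indicator_of_notMem (by exact hσ), mul_zero, add_zero]
          exact (hf (Real.dist_eq (X N σ) c ▸ not_le.1 hσ)).le
    _ ≤ _ := by
        rw [expect_add, expect_const_mul, prob]
        gcongr
        exact expect_const_le (half_pos hε).le

lemma tendstoInMean_prod (J : Finset ℕ) {X : (N : ℕ) → ℕ → Equiv.Perm (Fin N) → ℝ} {c B : ℕ → ℝ}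
    (hB : ∀ N j σ, |X N j σ| ≤ B j)
    (hX : ∀ j ∈ J, TendstoInMean θ κ (fun N σ => X N j σ) (c j)) :
    TendstoInMean θ κ (fun N σ => ∏ j ∈ J, X N j σ) (∏ j ∈ J, c j) := by
  classical
  induction J using Finset.induction_on with
  | empty => simp [TendstoInMean, expect]
  | insert i J hi ih =>
    have hlim := ((ih fun j hj => hX j (Finset.mem_insert_of_mem hj)).const_mul (B i)).add
      ((hX i (Finset.mem_insert_self i J)).const_mul |∏ j ∈ J, c j|)
    rw [mul_zero, mul_zero, add_zero] at hlim
    refine squeeze_zero (fun N => expect_nonneg hθ hκ fun σ => abs_nonneg _) (fun N => ?_) hlim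
    simp only [← expect_const_mul, ← expect_add]
    refine expect_mono hθ hκ fun σ => ?_
    rw [Finset.prod_insert hi, Finset.prod_insert hi]
    calc |X N i σ * ∏ j ∈ J, X N j σ - c i * ∏ j ∈ J, c j|
        = |X N i σ * (∏ j ∈ J, X N j σ - ∏ j ∈ J, c j) + (∏ j ∈ J, c j) * (X N i σ - c i)| := by
          ring_nf
      _ ≤ _ := (abs_add_le _ _).trans (by
          rw [abs_mul, abs_mul]
          gcongr
          exact hB N i σ)

lemma tendsto_expect_mul {X Y : (N : ℕ) → Equiv.Perm (Fin N) → ℝ} {x y B : ℝ}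
    (hB : ∀ N σ, |X N σ| ≤ B) (hX : Tendsto (fun N => expect θ κ N (X N)) atTop (𝓝 x))
    (hY : TendstoInMean θ κ Y y) :
    Tendsto (fun N => expect θ κ N fun σ => X N σ * Y N σ) atTop (𝓝 (x * y)) := by
  have herr := hY.const_mul B
  rw [mul_zero] at herr
  have hdiff : Tendsto (fun N => expect θ κ N (fun σ => X N σ * Y N σ) - expect θ κ N (X N) * y)
      atTop (𝓝 0) := by
    refine squeeze_zero_norm (fun N => ?_) herr
    rw [mul_comm, ← expect_const_mul, ← expect_const_mul, Real.norm_eq_abs]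
    refine abs_expect_sub_le hθ hκ fun σ => ?_
    rw [mul_comm y, ← mul_sub, abs_mul]
    exact mul_le_mul_of_nonneg_right (hB N σ) (abs_nonneg _)
  simpa using hdiff.add (hX.mul_const y)

end TendstoInMean

/-! ### Factorial moments and the law of large numbers -/

namespace SaddlePoint

variable {θ κ : ℕ → ℝ} {r : ℝ}

lemma tendsto_expect_const (h : SaddlePoint θ κ r) (c : ℝ) :
    Tendsto (fun N : ℕ => expect θ κ N fun _ => c) atTop (𝓝 c) := by
  refine tendsto_const_nhds.congr' ?_
  filter_upwards [h.eventually_partSum_pos 0] with N hN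
  rw [expect_const, div_self (by exact hN.ne'), mul_one]

lemma tendsto_scaled_moments (h : SaddlePoint θ κ r) {T : Finset ℕ} (hT : ∀ j ∈ T, 1 ≤ j)
    {s a : ℕ → ℝ} (ha : ∀ j ∈ T, Tendsto (fun N => cycleParam θ κ N j / s N) atTop (𝓝 (a j)))
    (n : ℕ → ℕ) :
    Tendsto (fun N : ℕ => (s N ^ ∑ j ∈ T, n j)⁻¹ *
      expect θ κ N (fun σ => ∏ j ∈ T, ((cycleCount j σ).descFactorial (n j) : ℝ)))
      atTop (𝓝 (∏ j ∈ T, (a j * r ^ j) ^ n j)) := by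
  have hlim := (tendsto_finsetProd T fun j hj => (ha j hj).pow (n j)).mul
    (h.tendsto_partSum_ratio (∑ j ∈ T, n j * j))
  have hprod : (∏ j ∈ T, a j ^ n j) * r ^ (∑ j ∈ T, n j * j) = ∏ j ∈ T, (a j * r ^ j) ^ n j := by
    simp_rw [← Finset.prod_pow_eq_pow_sum, ← Finset.prod_mul_distrib, mul_pow, ← pow_mul, mul_comm]
  rw [hprod] at hlim
  refine hlim.congr' ?_
  filter_upwards [eventually_ge_atTop (∑ j ∈ T, n j * j)] with N hN
  simp_rw [expect_prod_descFactorial θ κ hT n hN, div_pow, Finset.prod_div_distrib,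
    Finset.prod_pow_eq_pow_sum]
  ring

theorem tendsto_normalized_moments (h : SaddlePoint θ κ r) {T : Finset ℕ} (hT : ∀ j ∈ T, 1 ≤ j)
    (n : ℕ → ℕ) :
    Tendsto (fun N : ℕ => ((N : ℝ) ^ ∑ j ∈ T, n j)⁻¹ *
      expect θ κ N (fun σ => ∏ j ∈ T, ((cycleCount j σ).descFactorial (n j) : ℝ)))
      atTop (𝓝 (∏ j ∈ T, limitDensity κ r j ^ n j)) := by
  simpa only [limitDensity, mul_div_right_comm] using
    h.tendsto_scaled_moments hT (fun j _ => tendsto_cycleParam_div θ κ j) n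

theorem tendsto_moments (h : SaddlePoint θ κ r) {T : Finset ℕ} (hT : ∀ j ∈ T, 1 ≤ j ∧ κ j = 0)
    (n : ℕ → ℕ) :
    Tendsto (fun N : ℕ =>
      expect θ κ N (fun σ => ∏ j ∈ T, ((cycleCount j σ).descFactorial (n j) : ℝ)))
      atTop (𝓝 (∏ j ∈ T, limitDensity θ r j ^ n j)) := by
  have hparam : ∀ j ∈ T, Tendsto (fun N => cycleParam θ κ N j / 1) atTop (𝓝 (θ j / j)) := by
    intro j hj
    simp only [cycleParam, (hT j hj).2, mul_zero, add_zero, div_one, tendsto_const_nhds]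
  simpa only [limitDensity, mul_div_right_comm, one_pow, inv_one, one_mul] using
    h.tendsto_scaled_moments (fun j hj => (hT j hj).1) hparam n

lemma tendsto_variance (h : SaddlePoint θ κ r) {j : ℕ} (hj : 1 ≤ j) :
    Tendsto (fun N : ℕ => expect θ κ N fun σ =>
      ((cycleCount j σ : ℝ) / N - limitDensity κ r j) ^ 2) atTop (𝓝 0) := by
  set c := limitDensity κ r j
  have moment (n : ℕ) : Tendsto (fun N : ℕ => ((N : ℝ) ^ n)⁻¹ *
      expect θ κ N (fun σ => ((cycleCount j σ).descFactorial n : ℝ))) atTop (𝓝 (c ^ n)) := by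
    simpa using h.tendsto_normalized_moments (T := {j}) (by simpa using hj) fun _ => n
  have hlim := (((moment 2).add ((moment 1).mul tendsto_inv_atTop_nhds_zero_nat)).sub
    ((moment 1).const_mul (2 * c))).add (h.tendsto_expect_const (c ^ 2))
  rw [show c ^ 2 + c ^ 1 * 0 - 2 * c * c ^ 1 + c ^ 2 = 0 by ring] at hlim
  refine hlim.congr fun N => ?_
  simp only [Nat.descFactorial_one, Nat.cast_descFactorial_two, mul_right_comm, ← mul_assoc]
  simp only [← expect_const_mul, ← expect_add, ← expect_sub]
  congr 1
  ext σ
  ring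

theorem tendstoInProb (h : SaddlePoint θ κ r) {j : ℕ} (hj : 1 ≤ j) :
    TendstoInProb θ κ (fun N σ => (cycleCount j σ : ℝ) / N) (limitDensity κ r j) :=
  tendstoInProb_of_tendsto_expect_sq h.θ_nonneg h.κ_nonneg (h.tendsto_variance hj)

end SaddlePoint

/-! ### Poisson limits from factorial moments -/

lemma prod_insert_update {ι α M : Type*} [DecidableEq ι] [CommMonoid M] (g : ι → α → M) {i : ι}
    {T : Finset ι} (hi : i ∉ T) (n : ι → α) (m : α) :
    ∏ j ∈ insert i T, g j (Function.update n i m j) = (∏ j ∈ T, g j (n j)) * g i m := by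
  rw [Finset.prod_insert hi, Function.update_self, mul_comm]
  congr 1
  exact Finset.prod_congr rfl fun j hj => by
    rw [Function.update_of_ne (ne_of_mem_of_not_mem hj hi)]

lemma tendsto_of_forall_abs_sub_le {y : ℕ → ℝ} {s e : ℕ → ℕ → ℝ} {s' e' : ℕ → ℝ} {L : ℝ}
    (hy : ∀ K N, |y N - s K N| ≤ e K N) (hs : ∀ K, Tendsto (s K) atTop (𝓝 (s' K)))
    (he : ∀ K, Tendsto (e K) atTop (𝓝 (e' K))) (hs' : Tendsto s' atTop (𝓝 L))
    (he' : Tendsto e' atTop (𝓝 0)) : Tendsto y atTop (𝓝 L) := by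
  refine tendsto_order.2 ⟨fun b hb => ?_, fun b hb => ?_⟩
  · have hlim := hs'.sub he'
    rw [sub_zero] at hlim
    obtain ⟨K, hK⟩ := (hlim.eventually_const_lt hb).exists
    filter_upwards [((hs K).sub (he K)).eventually_const_lt hK] with N hN
    linarith [(abs_le.1 (hy K N)).1]
  · have hlim := hs'.add he'
    rw [add_zero] at hlim
    obtain ⟨K, hK⟩ := (hlim.eventually_lt_const hb).exists
    filter_upwards [((hs K).add (he K)).eventually_lt_const hK] with N hN
    linarith [(abs_le.1 (hy K N)).2]

lemma abs_ite_sub_alternating_sum_choose_le (m K : ℕ) :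
    |(if m = 0 then 1 else 0) - ∑ k ∈ Finset.range K, (-1 : ℤ) ^ k * m.choose k| ≤ m.choose K := by
  rcases m with _ | m
  · rcases K with _ | K
    · simp
    · simp [Finset.sum_range_succ']
  · rcases K with _ | K
    · simp
    · rw [Int.alternating_sum_range_choose_eq_choose, if_neg m.succ_ne_zero, zero_sub, abs_neg,
        abs_mul, abs_neg_one_pow, one_mul, Nat.choose_succ_succ, Nat.abs_cast]
      exact_mod_cast Nat.le_add_right _ _

lemma descFactorial_add_eq_mul_choose (c n k : ℕ) :
    c.descFactorial (n + k) = n.factorial * k.factorial * (c.choose n * (c - n).choose k) := by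
  rw [← Nat.descFactorial_mul_descFactorial (Nat.le_add_right n k), Nat.add_sub_cancel_left,
    Nat.descFactorial_eq_factorial_mul_choose, Nat.descFactorial_eq_factorial_mul_choose]
  ring

/-- Bonferroni's inequalities for the number `c` of events that occur. -/
lemma abs_ite_eq_sub_sum_descFactorial_le (c n K : ℕ) :
    |(if c = n then 1 else 0) - ∑ k ∈ Finset.range K,
        (-1 : ℝ) ^ k / (n.factorial * k.factorial) * c.descFactorial (n + k)| ≤
      c.descFactorial (n + K) / (n.factorial * K.factorial) := by
  rcases lt_or_ge c n with hc | hc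
  · simp [hc.ne, Nat.descFactorial_of_lt (hc.trans_le (Nat.le_add_right n _))]
  have hchoose (k : ℕ) : (c.descFactorial (n + k) : ℝ) =
      n.factorial * k.factorial * (c.choose n * (c - n).choose k) := by
    exact_mod_cast descFactorial_add_eq_mul_choose c n k
  have hbonf : |(if c - n = 0 then 1 else 0) -
      ∑ k ∈ Finset.range K, (-1 : ℝ) ^ k * (c - n).choose k| ≤ (c - n).choose K := by
    exact_mod_cast abs_ite_sub_alternating_sum_choose_le (c - n) K
  have hite : (if c = n then (1 : ℝ) else 0) = c.choose n * if c - n = 0 then 1 else 0 := by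
    rcases hc.eq_or_lt with rfl | hlt
    · simp
    · rw [if_neg hlt.ne', if_neg (Nat.sub_ne_zero_of_lt hlt), mul_zero]
  calc _ = c.choose n * |(if c - n = 0 then 1 else 0) -
        ∑ k ∈ Finset.range K, (-1 : ℝ) ^ k * (c - n).choose k| := by
        conv_rhs => rw [← Nat.abs_cast (c.choose n), ← abs_mul, mul_sub, ← hite, Finset.mul_sum]
        congr 2
        refine Finset.sum_congr rfl fun k _ => ?_
        rw [hchoose]
        field_simp
    _ ≤ c.choose n * (c - n).choose K := by gcongr
    _ = _ := by
        rw [hchoose]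
        field_simp

/-- Truncation at `K`, with the tail bounded by `1{c > K} ≤ c / (K + 1)`. -/
lemma abs_sub_sum_ite_eq_le {f : ℕ → ℝ} {B : ℝ} (hf : ∀ k, |f k| ≤ B) (K c : ℕ) :
    |f c - ∑ k ∈ Finset.range (K + 1), f k * if c = k then 1 else 0| ≤ B / (K + 1) * c := by
  have hB : 0 ≤ B := (abs_nonneg _).trans (hf 0)
  simp only [mul_ite, mul_one, mul_zero, Finset.sum_ite_eq, Finset.mem_range]
  split_ifs with hc
  · rw [sub_self, abs_zero]
    positivity
  · rw [sub_zero, div_mul_eq_mul_div, le_div_iff₀ (by positivity)]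
    refine mul_le_mul (hf c) ?_ (by positivity) hB
    exact_mod_cast not_lt.1 hc

lemma hasSum_alternating_moments (a l : ℝ) (n : ℕ) :
    HasSum (fun k : ℕ => (-1 : ℝ) ^ k / (n.factorial * k.factorial) * (a * l ^ (n + k)))
      (a * (Real.exp (-l) * l ^ n / n.factorial)) := by
  have hexp : HasSum (fun k : ℕ => (-l) ^ k / k.factorial) (Real.exp (-l)) := by
    rw [Real.exp_eq_exp_ℝ]
    exact NormedSpace.expSeries_div_hasSum_exp (-l)
  convert! hexp.mul_left (a * l ^ n / n.factorial) using 1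
  · ext k
    rw [neg_pow l, pow_add]
    field_simp
  · ring

section Poisson

variable {θ κ : ℕ → ℝ} (hθ : ∀ j, 1 ≤ j → 0 ≤ θ j) (hκ : ∀ j, 1 ≤ j → 0 ≤ κ j)
include hθ hκ

lemma abs_expect_mul_sub_sum_le {N : ℕ} {ι : Type*} {s : Finset ι}
    {A D F E : Equiv.Perm (Fin N) → ℝ} {G : ι → Equiv.Perm (Fin N) → ℝ} {c : ι → ℝ} {e : ℝ}
    (hAD : ∀ σ, |A σ| ≤ D σ)
    (hF : ∀ σ, |F σ - ∑ k ∈ s, c k * G k σ| ≤ e * E σ) :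
    |expect θ κ N (fun σ => A σ * F σ) - ∑ k ∈ s, c k * expect θ κ N fun σ => A σ * G k σ| ≤
      e * expect θ κ N fun σ => D σ * E σ := by
  simp only [← expect_const_mul, ← expect_sum, mul_left_comm _ (A _), mul_left_comm _ (D _),
    ← Finset.mul_sum]
  refine abs_expect_sub_le hθ hκ fun σ => ?_
  rw [← mul_sub, abs_mul]
  exact mul_le_mul (hAD σ) (hF σ) (abs_nonneg _) ((abs_nonneg _).trans (hAD σ))

section OneVariable

variable {A D : (N : ℕ) → Equiv.Perm (Fin N) → ℝ} {X : (N : ℕ) → Equiv.Perm (Fin N) → ℕ}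
  {a d : ℝ} {l : ℝ≥0}
  (hAD : ∀ N σ, |A N σ| ≤ D N σ)
  (hA : ∀ n : ℕ, Tendsto (fun N => expect θ κ N fun σ => A N σ * (X N σ).descFactorial n) atTop
    (𝓝 (a * l ^ n)))
  (hD : ∀ n : ℕ, Tendsto (fun N => expect θ κ N fun σ => D N σ * (X N σ).descFactorial n) atTop
    (𝓝 (d * l ^ n)))
include hAD hA hD

lemma tendsto_expect_mul_ite_eq (n : ℕ) :
    Tendsto (fun N => expect θ κ N fun σ => A N σ * if X N σ = n then 1 else 0) atTop
      (𝓝 (a * (Real.exp (-l) * l ^ n / n.factorial))) := by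
  refine tendsto_of_forall_abs_sub_le (fun K N => ?_)
    (fun K => tendsto_finsetSum (Finset.range K) fun k _ =>
      (hA (n + k)).const_mul ((-1 : ℝ) ^ k / (n.factorial * k.factorial)))
    (fun K => (hD (n + K)).const_mul (1 / (n.factorial * K.factorial : ℝ)))
    (hasSum_alternating_moments a l n).tendsto_sum_nat ?_
  · refine abs_expect_mul_sub_sum_le hθ hκ (hAD N) fun σ => ?_
    rw [one_div_mul_eq_div]
    exact abs_ite_eq_sub_sum_descFactorial_le (X N σ) n K
  · have hlim := (FloorSemiring.tendsto_pow_div_factorial_atTop (l : ℝ)).const_mul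
      (d * l ^ n / n.factorial)
    rw [mul_zero] at hlim
    refine hlim.congr fun K => ?_
    rw [pow_add]
    field_simp

lemma tendsto_expect_mul_of_bounded {f : ℕ → ℝ} {B : ℝ} (hf : ∀ k, |f k| ≤ B) :
    Tendsto (fun N => expect θ κ N fun σ => A N σ * f (X N σ)) atTop
      (𝓝 (a * ∫ k, f k ∂poissonMeasure l)) := by
  have hsum : HasSum (fun k : ℕ => f k * (a * (Real.exp (-l) * l ^ k / k.factorial)))
      (a * ∫ k, f k ∂poissonMeasure l) := by
    have hint : MeasureTheory.Integrable f (poissonMeasure l) :=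
      .of_bound .of_discrete B (.of_forall hf)
    convert! (hasSum_integral_poissonMeasure hint).mul_left a using 2 with k
    rw [smul_eq_mul]
    ring
  refine tendsto_of_forall_abs_sub_le (fun K N => ?_)
    (fun K => tendsto_finsetSum (Finset.range (K + 1)) fun k _ =>
      (tendsto_expect_mul_ite_eq hθ hκ hAD hA hD k).const_mul (f k))
    (fun K => (hD 1).const_mul (B / (K + 1)))
    (hsum.tendsto_sum_nat.comp (tendsto_add_atTop_nat 1)) ?_
  · refine abs_expect_mul_sub_sum_le hθ hκ (hAD N) fun σ => ?_
    rw [Nat.descFactorial_one]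
    exact abs_sub_sum_ite_eq_le hf K (X N σ)
  · have hlim := (tendsto_one_div_add_atTop_nhds_zero_nat (𝕜 := ℝ)).const_mul (B * (d * l))
    rw [mul_zero] at hlim
    refine hlim.congr fun K => ?_
    ring

end OneVariable

theorem tendsto_expect_prod_of_moments {X : (N : ℕ) → ℕ → Equiv.Perm (Fin N) → ℕ} {U : Set ℕ}
    {l : ℕ → ℝ≥0}
    (hX : ∀ T : Finset ℕ, ↑T ⊆ U → ∀ n : ℕ → ℕ,
      Tendsto (fun N => expect θ κ N fun σ => ∏ j ∈ T, ((X N j σ).descFactorial (n j) : ℝ)) atTop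
        (𝓝 (∏ j ∈ T, (l j : ℝ) ^ n j)))
    {f : ℕ → ℕ → ℝ} {B : ℕ → ℝ} (hf : ∀ j k, |f j k| ≤ B j) {S : Finset ℕ} (hS : ↑S ⊆ U) :
    Tendsto (fun N => expect θ κ N fun σ => ∏ j ∈ S, f j (X N j σ)) atTop
      (𝓝 (∏ j ∈ S, ∫ k, f j k ∂poissonMeasure (l j))) := by
  classical
  -- Replace the factorials by the `f j` one index at a time.
  suffices hmixed : ∀ T : Finset ℕ, ↑T ⊆ U → Disjoint S T → ∀ n : ℕ → ℕ,
      Tendsto (fun N => expect θ κ N fun σ =>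
        (∏ j ∈ S, f j (X N j σ)) * ∏ j ∈ T, ((X N j σ).descFactorial (n j) : ℝ)) atTop
        (𝓝 ((∏ j ∈ S, ∫ k, f j k ∂poissonMeasure (l j)) * ∏ j ∈ T, (l j : ℝ) ^ n j)) by
    simpa using hmixed ∅ (by simp) (by simp) 0
  induction S using Finset.induction_on with
  | empty => simpa using fun T hT => hX T hT
  | insert i S hi ih =>
    intro T hT hdisj n
    rw [Finset.coe_insert, Set.insert_subset_iff] at hS
    rw [Finset.disjoint_insert_left] at hdisj
    have hiT : ↑(insert i T) ⊆ U := by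
      rw [Finset.coe_insert]
      exact Set.insert_subset hS.1 hT
    have prod_descFactorial_update (N : ℕ) (σ : Equiv.Perm (Fin N)) (m : ℕ) :=
      prod_insert_update (fun j k => ((X N j σ).descFactorial k : ℝ)) hdisj.1 n m
    have prod_pow_update (m : ℕ) := prod_insert_update (fun j k => (l j : ℝ) ^ k) hdisj.1 n m
    have hlim := tendsto_expect_mul_of_bounded hθ hκ (X := fun N => X N i) (l := l i)
      (a := (∏ j ∈ S, ∫ k, f j k ∂poissonMeasure (l j)) * ∏ j ∈ T, (l j : ℝ) ^ n j)
      (d := (∏ j ∈ S, B j) * ∏ j ∈ T, (l j : ℝ) ^ n j)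
      (A := fun N σ => (∏ j ∈ S, f j (X N j σ)) * ∏ j ∈ T, ((X N j σ).descFactorial (n j) : ℝ))
      (D := fun N σ => (∏ j ∈ S, B j) * ∏ j ∈ T, ((X N j σ).descFactorial (n j) : ℝ))
      (fun N σ => ?_) (fun m => ?_) (fun m => ?_) (hf i)
    · simpa only [Finset.prod_insert hi, mul_assoc, mul_comm, mul_left_comm] using hlim
    · rw [abs_mul, Finset.abs_prod, abs_of_nonneg (Finset.prod_nonneg fun j _ => Nat.cast_nonneg _)]
      gcongr with j
      exact hf j _
    · have := ih hS.2 (insert i T) hiT (by simp [hi, hdisj.2]) (Function.update n i m)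
      simpa only [prod_descFactorial_update, prod_pow_update, mul_assoc] using this
    · have := (hX (insert i T) hiT (Function.update n i m)).const_mul (∏ j ∈ S, B j)
      simpa only [prod_descFactorial_update, prod_pow_update, mul_assoc, ← expect_const_mul]
        using this

end Poisson

/-! ### The joint limit law -/

lemma asympIndep_of_tendsto {θ κ : ℕ → ℝ} {X : (N : ℕ) → ℕ → Equiv.Perm (Fin N) → ℝ}
    {L : ℕ → (ℝ →ᵇ ℝ) → ℝ}
    (hX : ∀ J : Finset ℕ, (∀ j ∈ J, 1 ≤ j) → ∀ f : ℕ → ℝ →ᵇ ℝ,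
      Tendsto (fun N => expect θ κ N fun σ => ∏ j ∈ J, f j (X N j σ)) atTop
        (𝓝 (∏ j ∈ J, L j (f j)))) :
    AsympIndep θ κ X := by
  intro J hJ f
  have hmarginal : ∀ j ∈ J, Tendsto (fun N => expect θ κ N fun σ => f j (X N j σ)) atTop
      (𝓝 (L j (f j))) := fun j hj => by
    simpa only [Finset.prod_singleton] using hX {j} (by simpa using hJ j hj) f
  simpa only [sub_self] using (hX J hJ f).sub (tendsto_finsetProd J hmarginal)

namespace SaddlePoint

variable {θ κ : ℕ → ℝ} {r : ℝ} (h : SaddlePoint θ κ r)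
include h

lemma tendsto_expect_prod_poisson {S : Finset ℕ} (hS : ∀ j ∈ S, 1 ≤ j ∧ κ j = 0)
    (f : ℕ → ℝ →ᵇ ℝ) :
    Tendsto (fun N => expect θ κ N fun σ => ∏ j ∈ S, f j (cycleCount j σ)) atTop
      (𝓝 (∏ j ∈ S, ∫ k : ℕ, f j k ∂poissonMeasure (limitDensity θ r j).toNNReal)) := by
  refine tendsto_expect_prod_of_moments (U := {j | 1 ≤ j ∧ κ j = 0})
    (f := fun j k => f j k) h.θ_nonneg h.κ_nonneg (fun T hT n => ?_)
    (fun j k => (f j).norm_coe_le_norm k) hS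
  have hcoe : ∀ j ∈ T, ((limitDensity θ r j).toNNReal : ℝ) ^ n j = limitDensity θ r j ^ n j :=
    fun j _ => by
      rw [Real.coe_toNNReal _ (limitDensity_nonneg h.θ_nonneg h.pos.le j)]
  rw [Finset.prod_congr rfl hcoe]
  exact h.tendsto_moments hT n

open Classical in
theorem tendsto_expect_prod {U : Set ℕ} (hU : ∀ j ∈ U, κ j = 0) {J : Finset ℕ}
    (hJ : ∀ j ∈ J, 1 ≤ j) (f : ℕ → ℝ →ᵇ ℝ) :
    Tendsto (fun N => expect θ κ N fun σ => ∏ j ∈ J, f j (if j ∈ U then (cycleCount j σ : ℝ)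
      else (cycleCount j σ : ℝ) / N)) atTop
      (𝓝 (∏ j ∈ J, if j ∈ U then ∫ k : ℕ, f j k ∂poissonMeasure (limitDensity θ r j).toNNReal
        else f j (limitDensity κ r j))) := by
  have hpoisson := h.tendsto_expect_prod_poisson (S := J.filter (· ∈ U))
    (fun j hj => ⟨hJ j (Finset.mem_filter.1 hj).1, hU j (Finset.mem_filter.1 hj).2⟩) f
  have hconst : TendstoInMean θ κ
      (fun N σ => ∏ j ∈ J.filter (· ∉ U), f j ((cycleCount j σ : ℝ) / N))
      (∏ j ∈ J.filter (· ∉ U), f j (limitDensity κ r j)) :=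
    tendstoInMean_prod h.θ_nonneg h.κ_nonneg (X := fun N j σ => f j ((cycleCount j σ : ℝ) / N))
      (J.filter (· ∉ U)) (fun N j σ => (f j).norm_coe_le_norm _) fun j hj =>
        tendstoInMean_comp h.θ_nonneg h.κ_nonneg
          (h.tendstoInProb (hJ j (Finset.mem_filter.1 hj).1)) (f j)
  have hbound (N : ℕ) (σ : Equiv.Perm (Fin N)) :
      |∏ j ∈ J.filter (· ∈ U), f j (cycleCount j σ)| ≤ ∏ j ∈ J.filter (· ∈ U), ‖f j‖ := by
    rw [Finset.abs_prod]
    exact Finset.prod_le_prod (fun j _ => abs_nonneg _) fun j _ => (f j).norm_coe_le_norm _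
  simpa only [apply_ite (f _), Finset.prod_ite] using
    tendsto_expect_mul h.θ_nonneg h.κ_nonneg hbound hpoisson hconst

open Classical in
theorem asympIndep {U : Set ℕ} (hU : ∀ j ∈ U, κ j = 0) :
    AsympIndep θ κ (fun N j σ => if j ∈ U then (cycleCount j σ : ℝ)
      else (cycleCount j σ : ℝ) / N) :=
  asympIndep_of_tendsto
    (L := fun j f => if j ∈ U then ∫ k : ℕ, f k ∂poissonMeasure (limitDensity θ r j).toNNReal
      else f (limitDensity κ r j))
    fun _ hJ f => h.tendsto_expect_prod hU hJ f

theorem tendstoPoisson {j : ℕ} (hj : 1 ≤ j) (hκj : κ j = 0) :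
    TendstoPoisson θ κ (fun _ σ => (cycleCount j σ : ℝ)) (limitDensity θ r j).toNNReal := by
  intro f
  simpa only [Finset.prod_singleton] using
    h.tendsto_expect_prod_poisson (S := {j}) (by simpa using ⟨hj, hκj⟩) fun _ => f

end SaddlePoint

/-! ### The point `r_*` -/

lemma Admissible.radius_pos_and_le {θ κ : ℕ → ℝ} (h : Admissible θ κ) :
    0 < radius κ ∧ radius κ ≤ radius θ := by
  rcases h with h | h | h | h | h | h
  · exact ⟨h.1, h.2.1⟩
  · obtain ⟨R, η, φ, θs, δ, Gθ, Gκ, hR, hrad, -, -, -, -, -, -, hθ, -⟩ := h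
    exact ⟨hrad ▸ ENNReal.ofReal_pos.2 hR, hrad ▸ hθ.le_radius⟩
  · obtain ⟨R, η, φ, s, as, δ, Gθ, Gκ, hR, hrad, -, -, -, -, -, -, -, -, -, -, hθ, -⟩ := h
    exact ⟨hrad ▸ ENNReal.ofReal_pos.2 hR, hrad ▸ hθ.le_radius⟩
  · obtain ⟨R, hR, hrad, hθ, -⟩ := h
    exact ⟨hrad ▸ ENNReal.ofReal_pos.2 hR, hrad ▸ hθ⟩
  · obtain ⟨R, η, φ, θs, δ, Gθ, Gκ, hR, hrad, -, -, -, -, -, -, -, -, hθ, -⟩ := h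
    exact ⟨hrad ▸ ENNReal.ofReal_pos.2 hR, hrad ▸ hθ.le_radius⟩
  · obtain ⟨R, η, φ, θs, s, as, δ, Gθ, Gκ, hR, hrad, -, -, -, -, -, -, -, -, -, hθ, -⟩ := h
    exact ⟨hrad ▸ ENNReal.ofReal_pos.2 hR, hrad ▸ hθ.le_radius⟩

lemma modDeriv_ofReal (a : ℕ → ℝ) (n : ℕ) {r : ℝ} (hr : 0 ≤ r) :
    modDeriv a n (ENNReal.ofReal r) =
      ∑' j : ℕ, ENNReal.ofReal (j.descFactorial n * limitDensity a r j) := by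
  refine tsum_congr fun j => ?_
  rw [← ENNReal.ofReal_pow hr, ← ENNReal.ofReal_mul' (pow_nonneg hr j), limitDensity, mul_assoc,
    div_mul_eq_mul_div]

section Radius

variable {a : ℕ → ℝ} (ha : ∀ j, 1 ≤ j → 0 ≤ a j)
include ha

lemma natCast_mul_limitDensity_nonneg {r : ℝ} (hr : 0 ≤ r) (j : ℕ) : 0 ≤ j * limitDensity a r j :=
  mul_nonneg j.cast_nonneg (limitDensity_nonneg ha hr j)

lemma natCast_mul_limitDensity_le {r s : ℝ} (hr : 0 ≤ r) (hrs : r ≤ s) (j : ℕ) :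
    j * limitDensity a r j ≤ j * limitDensity a s j :=
  mul_le_mul_of_nonneg_left (limitDensity_le_limitDensity ha hr hrs j) j.cast_nonneg

lemma modDeriv_one_ofReal {r : ℝ} (hr : 0 ≤ r)
    (hsum : Summable fun j : ℕ => j * limitDensity a r j) :
    modDeriv a 1 (ENNReal.ofReal r) = ENNReal.ofReal (∑' j : ℕ, j * limitDensity a r j) := by
  simp only [modDeriv_ofReal a 1 hr, Nat.descFactorial_one,
    ENNReal.ofReal_tsum_of_nonneg (natCast_mul_limitDensity_nonneg ha hr) hsum]

lemma summable_of_modDeriv_one_ne_top {r : ℝ} (hr : 0 ≤ r)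
    (h : modDeriv a 1 (ENNReal.ofReal r) ≠ ∞) : Summable fun j : ℕ => j * limitDensity a r j := by
  rw [modDeriv_ofReal a 1 hr] at h
  simpa only [Nat.descFactorial_one,
    ENNReal.toReal_ofReal (natCast_mul_limitDensity_nonneg ha hr _)] using ENNReal.summable_toReal h

lemma modDeriv_one_lt_modDeriv_one {i : ℕ} (hi : i ∈ posIndices a) {r s : ℝ} (hr : 0 ≤ r)
    (hrs : r < s) (h : modDeriv a 1 (ENNReal.ofReal r) ≠ ∞) :
    modDeriv a 1 (ENNReal.ofReal r) < modDeriv a 1 (ENNReal.ofReal s) := by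
  have hs : 0 < s := hr.trans_lt hrs
  rw [modDeriv_ofReal a 1 hr] at h ⊢
  simp only [modDeriv_ofReal a 1 hs.le, Nat.descFactorial_one] at h ⊢
  refine ENNReal.tsum_lt_tsum (i := i) h
    (fun j => ENNReal.ofReal_le_ofReal (natCast_mul_limitDensity_le ha hr hrs.le j)) ?_
  rw [natCast_mul_limitDensity a r hi.1, natCast_mul_limitDensity a s hi.1,
    ENNReal.ofReal_lt_ofReal_iff (mul_pos hi.2 (pow_pos hs i))]
  exact mul_lt_mul_of_pos_left (pow_lt_pow_left₀ hrs hr (Nat.one_le_iff_ne_zero.1 hi.1)) hi.2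

lemma norm_ofScalars_mul_pow {r : ℝ} (hr : 0 ≤ r) (j : ℕ) :
    ‖FormalMultilinearSeries.ofScalars ℂ (fun j : ℕ => ((a j / j : ℝ) : ℂ)) j‖ *
      (r.toNNReal : ℝ) ^ j = limitDensity a r j := by
  rw [FormalMultilinearSeries.ofScalars_norm, Complex.norm_real, Real.norm_eq_abs,
    Real.coe_toNNReal r hr, ← abs_of_nonneg (pow_nonneg hr j), ← abs_mul, div_mul_eq_mul_div]
  exact abs_of_nonneg (limitDensity_nonneg ha hr j)

lemma summable_limitDensity_of_lt_radius {r : ℝ} (hr : 0 ≤ r)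
    (h : ENNReal.ofReal r < radius a) : Summable (limitDensity a r) :=
  (FormalMultilinearSeries.summable_norm_mul_pow _ h).congr (norm_ofScalars_mul_pow ha hr)

lemma summable_natCast_mul_limitDensity_of_lt_radius {r : ℝ} (hr : 0 ≤ r)
    (h : ENNReal.ofReal r < radius a) : Summable fun j : ℕ => j * limitDensity a r j := by
  obtain ⟨b, hb, C, -, hle⟩ := FormalMultilinearSeries.norm_mul_pow_le_mul_pow_of_lt_radius _ h
  have hgeom : Summable fun j : ℕ => C * ((j : ℝ) ^ 1 * b ^ j) :=
    (summable_pow_mul_geometric_of_norm_lt_one 1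
      (by rw [Real.norm_of_nonneg hb.1.le]; exact hb.2)).mul_left C
  refine hgeom.of_nonneg_of_le (natCast_mul_limitDensity_nonneg ha hr) fun j => ?_
  rw [pow_one, mul_left_comm, ← norm_ofScalars_mul_pow ha hr]
  exact mul_le_mul_of_nonneg_left (hle j) j.cast_nonneg

lemma ofReal_le_radius_of_limitDensity_le {r C : ℝ} (hr : 0 ≤ r)
    (h : ∀ j, limitDensity a r j ≤ C) : ENNReal.ofReal r ≤ radius a :=
  FormalMultilinearSeries.le_radius_of_bound _ C fun j =>
    (norm_ofScalars_mul_pow ha hr j).trans_le (h j)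

/-- At the radius of convergence, the coefficients do not decay exponentially. -/
lemma exists_fillRate_lt_of_ofReal_eq_radius {r : ℝ} (hr : 0 < r)
    (hR : ENNReal.ofReal r = radius a) {ε : ℝ} (hε : 0 < ε) :
    ∃ i ∈ posIndices a, fillRate (limitDensity a r) i < ε := by
  by_contra! hrate
  have hbound (j : ℕ) : limitDensity a (r * Real.exp ε) j ≤ 1 := by
    rcases Nat.eq_zero_or_pos j with rfl | hj
    · simp [limitDensity]
    rcases (ha j hj).eq_or_lt with hzero | hpos
    · simp [limitDensity, ← hzero]
    have hj0 : (0 : ℝ) < j := Nat.cast_pos.2 hj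
    have hdecay : a j * r ^ j ≤ Real.exp (-(ε * j)) := by
      have := hrate j ⟨hj, hpos⟩
      rw [fillRate, natCast_mul_limitDensity a r hj, le_div_iff₀ hj0] at this
      rw [← Real.log_le_iff_le_exp (mul_pos hpos (pow_pos hr j))]
      linarith
    calc limitDensity a (r * Real.exp ε) j
        ≤ a j * (r * Real.exp ε) ^ j :=
          div_le_self (by positivity) (Nat.one_le_cast.2 hj)
      _ = a j * r ^ j * Real.exp (ε * j) := by
          rw [mul_pow, ← Real.exp_nat_mul, mul_comm (j : ℝ), mul_assoc]
      _ ≤ Real.exp (-(ε * j)) * Real.exp (ε * j) := by gcongr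
      _ = 1 := by rw [← Real.exp_add, neg_add_cancel, Real.exp_zero]
  have hle := ofReal_le_radius_of_limitDensity_le ha (by positivity) hbound
  rw [← hR, ENNReal.ofReal_le_ofReal_iff hr.le, mul_le_iff_le_one_right hr, Real.exp_le_one_iff]
    at hle
  exact hle.not_gt hε

end Radius

section RStar

variable {κ : ℕ → ℝ}

lemma exists_lt_radius_one_lt_modDeriv_one (h0 : 0 < radius κ) (h : 1 < modDeriv κ 1 (radius κ)) :
    ∃ x : ℝ≥0∞, x < radius κ ∧ 1 < modDeriv κ 1 x := by
  rw [modDeriv, ENNReal.tsum_eq_iSup_sum, lt_iSup_iff] at h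
  obtain ⟨s, hs⟩ := h
  have hcont : Continuous fun x : ℝ≥0∞ =>
      ∑ j ∈ s, ENNReal.ofReal ((j.descFactorial 1 : ℝ) * (κ j / j)) * x ^ j :=
    continuous_finsetSum _ fun j _ =>
      (ENNReal.continuous_const_mul ENNReal.ofReal_ne_top).comp (ENNReal.continuous_pow j)
  have : (𝓝[<] radius κ).NeBot := nhdsLT_neBot_of_exists_lt ⟨0, h0⟩
  obtain ⟨x, hx, hlt⟩ := ((((hcont.tendsto (radius κ)).eventually_const_lt hs).filter_mono
    nhdsWithin_le_nhds).and (self_mem_nhdsWithin (s := Set.Iio (radius κ)))).exists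
  exact ⟨x, hlt, hx.trans_le (ENNReal.sum_le_tsum s)⟩

lemma radius_ne_top {i : ℕ} (hi : i ∈ posIndices κ) (h : modDeriv κ 1 (radius κ) ≠ ∞) :
    radius κ ≠ ∞ := by
  intro htop
  have hi0 : (0 : ℝ) < i := Nat.cast_pos.2 hi.1
  have hi1 := hi.2
  refine ENNReal.ne_top_of_tsum_ne_top h i ?_
  rw [htop, ENNReal.top_pow (Nat.one_le_iff_ne_zero.1 hi.1), Nat.descFactorial_one]
  exact ENNReal.mul_top (ENNReal.ofReal_pos.2 (by positivity)).ne'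

variable (hκ : ∀ j, 1 ≤ j → 0 ≤ κ j)
include hκ

lemma continuousOn_tsum_natCast_mul_limitDensity {s : ℝ}
    (hsum : Summable fun j : ℕ => j * limitDensity κ s j) :
    ContinuousOn (fun r => ∑' j : ℕ, j * limitDensity κ r j) (Set.Icc 0 s) := by
  refine continuousOn_tsum (fun j => ?_) hsum fun j r hr => ?_
  · unfold limitDensity
    fun_prop
  · rw [Real.norm_of_nonneg (natCast_mul_limitDensity_nonneg hκ hr.1 j)]
    exact natCast_mul_limitDensity_le hκ hr.1 hr.2 j

lemma exists_modDeriv_one_eq_one (h0 : 0 < radius κ) (h : 1 < modDeriv κ 1 (radius κ)) :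
    ∃ r : ℝ, 0 < r ∧ ENNReal.ofReal r ≤ radius κ ∧ modDeriv κ 1 (ENNReal.ofReal r) = 1 := by
  obtain ⟨x, hx, hlt⟩ := exists_lt_radius_one_lt_modDeriv_one h0 h
  lift x to ℝ≥0 using hx.ne_top
  rw [← ENNReal.ofReal_coe_nnreal] at hx hlt
  have hs : (0 : ℝ) ≤ x := x.coe_nonneg
  have hsum := summable_natCast_mul_limitDensity_of_lt_radius hκ hs hx
  rw [modDeriv_one_ofReal hκ hs hsum, ENNReal.one_lt_ofReal] at hlt
  have hzero : ∑' j : ℕ, j * limitDensity κ 0 j = 0 := by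
    refine (tsum_congr fun j => ?_).trans tsum_zero
    rcases Nat.eq_zero_or_pos j with rfl | hj
    · simp
    · rw [natCast_mul_limitDensity κ 0 hj, zero_pow hj.ne', mul_zero]
  obtain ⟨r, hr, hroot⟩ := intermediate_value_Icc hs
    (continuousOn_tsum_natCast_mul_limitDensity hκ hsum)
    (show (1 : ℝ) ∈ Set.Icc _ _ from ⟨hzero.trans_le zero_le_one, hlt.le⟩)
  dsimp only at hroot
  have hr0 : r ≠ 0 := by
    rintro rfl
    exact zero_ne_one (hzero.symm.trans hroot)
  refine ⟨r, hr.1.lt_of_ne' hr0, (ENNReal.ofReal_le_ofReal hr.2).trans hx.le, ?_⟩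
  rw [modDeriv_one_ofReal hκ hr.1 (hsum.of_nonneg_of_le (natCast_mul_limitDensity_nonneg hκ hr.1)
    (natCast_mul_limitDensity_le hκ hr.1 hr.2)), hroot, ENNReal.ofReal_one]

lemma exists_isRStar {i : ℕ} (hi : i ∈ posIndices κ) (h0 : 0 < radius κ) :
    ∃ r : ℝ, IsRStar κ r := by
  rcases lt_or_ge 1 (modDeriv κ 1 (radius κ)) with h | h
  · obtain ⟨r, hr, hrR, hroot⟩ := exists_modDeriv_one_eq_one hκ h0 h
    exact ⟨r, hr, hrR, fun _ => hroot, fun hle => absurd h hle.not_gt⟩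
  · have htop := radius_ne_top hi (h.trans_lt ENNReal.one_lt_top).ne
    have hR := ENNReal.ofReal_toReal htop
    exact ⟨(radius κ).toReal, ENNReal.toReal_pos h0.ne' htop, hR.le,
      fun hge => by rw [hR]; exact le_antisymm h hge, fun _ => hR⟩

lemma IsRStar.unique {i : ℕ} (hi : i ∈ posIndices κ) {r s : ℝ} (hr : IsRStar κ r)
    (hs : IsRStar κ s) : r = s := by
  rcases le_total 1 (modDeriv κ 1 (radius κ)) with h | h
  · wlog hrs : r < s generalizing r s
    · by_contra hne
      exact hne (this hs hr ((not_lt.1 hrs).lt_of_ne' hne)).symm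
    have hlt := modDeriv_one_lt_modDeriv_one hκ hi hr.pos.le hrs
      (hr.root h ▸ ENNReal.one_ne_top)
    rw [hr.root h, hs.root h] at hlt
    exact absurd hlt (lt_irrefl 1)
  · exact (ENNReal.ofReal_eq_ofReal_iff hr.pos.le hs.pos.le).1
      ((hr.boundary h).trans (hs.boundary h).symm)

theorem existsUnique_isRStar {i : ℕ} (hi : i ∈ posIndices κ) (h0 : 0 < radius κ) :
    ∃! r : ℝ, IsRStar κ r :=
  existsUnique_of_exists_of_unique (exists_isRStar hκ hi h0) fun _ _ => IsRStar.unique hκ hi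

lemma setGcd_posIndices_eq_one
    (hNA : ¬ ∃ d : ℕ, 1 < d ∧ ∀ j : ℕ, 1 ≤ j → κ j ≠ 0 → d ∣ j) :
    Nat.setGcd (posIndices κ) = 1 := by
  have hdvd : ∀ j : ℕ, 1 ≤ j → κ j ≠ 0 → Nat.setGcd (posIndices κ) ∣ j := fun j hj hne =>
    Nat.setGcd_dvd_of_mem ⟨hj, (hκ j hj).lt_of_ne' hne⟩
  by_contra hne
  rcases Nat.eq_zero_or_pos (Nat.setGcd (posIndices κ)) with hzero | hpos
  · refine hNA ⟨2, one_lt_two, fun j hj hj0 => ?_⟩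
    have := Nat.eq_zero_of_zero_dvd (hzero ▸ hdvd j hj hj0)
    omega
  · exact hNA ⟨_, lt_of_le_of_ne' hpos hne, hdvd⟩

lemma IsRStar.summable_and_tsum_le_one {r : ℝ} (h : IsRStar κ r) :
    (Summable fun j : ℕ => j * limitDensity κ r j) ∧ ∑' j : ℕ, j * limitDensity κ r j ≤ 1 := by
  have hle : modDeriv κ 1 (ENNReal.ofReal r) ≤ 1 := by
    rcases le_total 1 (modDeriv κ 1 (radius κ)) with hR | hR
    · exact (h.root hR).le
    · rwa [h.boundary hR]
  have hsum := summable_of_modDeriv_one_ne_top hκ h.pos.le (hle.trans_lt ENNReal.one_lt_top).ne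
  rw [modDeriv_one_ofReal hκ h.pos.le hsum, ENNReal.ofReal_le_one] at hle
  exact ⟨hsum, hle⟩

lemma IsRStar.exists_fillRate_mul_lt {r : ℝ} (h : IsRStar κ r) {i : ℕ} (hi : i ∈ posIndices κ)
    {ε : ℝ} (hε : 0 < ε) :
    ∃ j ∈ posIndices κ,
      fillRate (limitDensity κ r) j * (1 - ∑' j : ℕ, j * limitDensity κ r j) < ε := by
  obtain ⟨hsum, hmass⟩ := h.summable_and_tsum_le_one hκ
  rcases lt_or_ge (modDeriv κ 1 (radius κ)) 1 with hR | hR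
  · obtain ⟨j, hj, hrate⟩ := exists_fillRate_lt_of_ofReal_eq_radius hκ h.pos
      (h.boundary hR.le) (half_pos hε)
    have hnonneg : 0 ≤ ∑' j : ℕ, j * limitDensity κ r j :=
      tsum_nonneg (natCast_mul_limitDensity_nonneg hκ h.pos.le)
    refine ⟨j, hj, ?_⟩
    calc _ ≤ ε / 2 * (1 - ∑' j : ℕ, j * limitDensity κ r j) :=
          mul_le_mul_of_nonneg_right hrate.le (sub_nonneg.2 hmass)
      _ ≤ ε / 2 := mul_le_of_le_one_right (half_pos hε).le (sub_le_self 1 hnonneg)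
      _ < ε := half_lt_self hε
  · have hroot := h.root hR
    rw [modDeriv_one_ofReal hκ h.pos.le hsum, ENNReal.ofReal_eq_one] at hroot
    exact ⟨i, hi, by rwa [hroot, sub_self, mul_zero]⟩

end RStar

theorem IsRStar.saddlePoint {θ κ : ℕ → ℝ} {r : ℝ} (h : IsRStar κ r)
    (hθ : ∀ j : ℕ, 1 ≤ j → 0 ≤ θ j) (hκ : ∀ j : ℕ, 1 ≤ j → 0 ≤ κ j)
    (hgcd : Nat.setGcd (posIndices κ) = 1) (hrad : ENNReal.ofReal r ≤ radius θ) :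
    SaddlePoint θ κ r where
  θ_nonneg := hθ
  κ_nonneg := hκ
  pos := h.pos
  summable_mass := (h.summable_and_tsum_le_one hκ).1
  mass_le_one := (h.summable_and_tsum_le_one hκ).2
  fill ε hε := by
    obtain ⟨i, hi, -⟩ := Nat.exists_ne_zero_of_setGcd_ne_zero (hgcd ▸ one_ne_zero)
    exact h.exists_fillRate_mul_lt hκ hi hε
  setGcd_eq_one := hgcd
  summable_θ ρ hρ hρr := summable_limitDensity_of_lt_radius hθ hρ.le
    (((ENNReal.ofReal_lt_ofReal_iff h.pos).2 hρr).trans_le hrad)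

end SurrogateSpatial

open SurrogateSpatial in
theorem mainTheorem5_general (θ κ : ℕ → ℝ)
    (hθ : ∀ j : ℕ, 1 ≤ j → 0 ≤ θ j) (hκ : ∀ j : ℕ, 1 ≤ j → 0 ≤ κ j)
    (hNA : ¬ ∃ d : ℕ, 1 < d ∧ ∀ j : ℕ, 1 ≤ j → κ j ≠ 0 → d ∣ j) (h0 : 0 < radius κ) :
    (∃! r : ℝ, IsRStar κ r) ∧
    ∀ r : ℝ, IsRStar κ r → ENNReal.ofReal r ≤ radius θ →
      (∀ (m : ℕ) (n : ℕ → ℕ),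
        Tendsto (fun N : ℕ => ((N : ℝ) ^ (∑ j ∈ Finset.Icc 1 m, n j))⁻¹ *
            expect θ κ N (fun σ => ∏ j ∈ Finset.Icc 1 m,
              ((cycleCount j σ).descFactorial (n j) : ℝ)))
          atTop (𝓝 (∏ j ∈ Finset.Icc 1 m, (κ j * r ^ j / j) ^ n j))) ∧
      AsympIndep θ κ (fun N j σ => (cycleCount j σ : ℝ) / N) ∧
      (∀ j : ℕ, 1 ≤ j →
        TendstoInProb θ κ (fun N σ => (cycleCount j σ : ℝ) / N) (κ j * r ^ j / j)) ∧
      (∀ j : ℕ, 1 ≤ j → κ j = 0 →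
        (∀ n : ℕ, Tendsto (fun N : ℕ => expect θ κ N
            (fun σ => ((cycleCount j σ).descFactorial n : ℝ)))
          atTop (𝓝 ((θ j * r ^ j / j) ^ n))) ∧
        TendstoPoisson θ κ (fun _ σ => (cycleCount j σ : ℝ)) (θ j * r ^ j / j).toNNReal) ∧
      (∀ U : Set ℕ, (∀ j ∈ U, κ j = 0) →
        AsympIndep θ κ (fun N j σ =>
          open Classical in
          if j ∈ U then (cycleCount j σ : ℝ) else (cycleCount j σ : ℝ) / N)) := by
  have hgcd := setGcd_posIndices_eq_one hκ hNA
  obtain ⟨i, hi, -⟩ := Nat.exists_ne_zero_of_setGcd_ne_zero (hgcd ▸ one_ne_zero)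
  refine ⟨existsUnique_isRStar hκ hi h0, fun r hr hrad => ?_⟩
  have h : SaddlePoint θ κ r := hr.saddlePoint hθ hκ hgcd hrad
  refine ⟨fun m n => h.tendsto_normalized_moments (fun j hj => (Finset.mem_Icc.1 hj).1) n, ?_,
    fun j hj => h.tendstoInProb hj, fun j hj hκj => ⟨fun n => ?_, h.tendstoPoisson hj hκj⟩,
    fun U hU => h.asympIndep hU⟩
  · simpa using h.asympIndep (U := ∅) (by simp)
  · simpa [limitDensity] using
      h.tendsto_moments (T := {j}) (by simpa using ⟨hj, hκj⟩) fun _ => n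

theorem mainTheorem5 (θ κ : ℕ → ℝ)
    (hθ : ∀ j : ℕ, 1 ≤ j → 0 ≤ θ j) (hκ : ∀ j : ℕ, 1 ≤ j → 0 ≤ κ j)
    (hNA : SurrogateSpatial.NonArithmetic κ)
    (hadm : SurrogateSpatial.Admissible θ κ) :
    (∃! r : ℝ, SurrogateSpatial.IsRStar κ r) ∧
    ∀ r : ℝ, SurrogateSpatial.IsRStar κ r →
      -- (a) normalized factorial moments
      (∀ (m : ℕ) (n : ℕ → ℕ),
        Tendsto (fun N : ℕ => ((N : ℝ) ^ (∑ j ∈ Finset.Icc 1 m, n j))⁻¹ *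
            SurrogateSpatial.expect θ κ N (fun σ => ∏ j ∈ Finset.Icc 1 m,
              ((SurrogateSpatial.cycleCount j σ).descFactorial (n j) : ℝ)))
          atTop (𝓝 (∏ j ∈ Finset.Icc 1 m, (κ j * r ^ j / j) ^ n j))) ∧
      -- (a) asymptotic independence and convergence in probability of the normalized counts
      SurrogateSpatial.AsympIndep θ κ
        (fun N j σ => (SurrogateSpatial.cycleCount j σ : ℝ) / N) ∧
      (∀ j : ℕ, 1 ≤ j → SurrogateSpatial.TendstoInProb θ κ
        (fun N σ => (SurrogateSpatial.cycleCount j σ : ℝ) / N) (κ j * r ^ j / j)) ∧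
      -- (b) factorial moments and Poisson limit
      (∀ j : ℕ, 1 ≤ j → κ j = 0 → 0 < θ j →
        (∀ n : ℕ, Tendsto (fun N : ℕ => SurrogateSpatial.expect θ κ N
            (fun σ => ((SurrogateSpatial.cycleCount j σ).descFactorial n : ℝ)))
          atTop (𝓝 ((θ j * r ^ j / j) ^ n))) ∧
        SurrogateSpatial.TendstoPoisson θ κ
          (fun N σ => (SurrogateSpatial.cycleCount j σ : ℝ)) (θ j * r ^ j / j).toNNReal) ∧
      -- (b) asymptotic independence, where counts `C_j` with `j ∈ U` are not normalized
      (∀ U : Set ℕ, (∀ j ∈ U, κ j = 0) →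
        SurrogateSpatial.AsympIndep θ κ (fun N j σ =>
          open Classical in
          if j ∈ U then (SurrogateSpatial.cycleCount j σ : ℝ)
          else (SurrogateSpatial.cycleCount j σ : ℝ) / N)) := by
  obtain ⟨h0, hrad⟩ := hadm.radius_pos_and_le
  obtain ⟨hexists, hlimits⟩ := mainTheorem5_general θ κ hθ hκ hNA.nonArith h0
  refine ⟨hexists, fun r hr => ?_⟩
  obtain ⟨hmoments, hindep, hprob, hpoisson, hindepU⟩ :=
    hlimits r hr (hr.le_radius.trans hrad)
  exact ⟨hmoments, hindep, hprob, fun j hj hκj _ => hpoisson j hj hκj, hindepU⟩
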